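/- Let $T>0$, let $0<H<\tfrac12$, and let $X$ be a separable real Hilbert space with scalar product $[\cdot,\cdot]$. Put $R(s,t)=\tfrac12\big(s^{2H}+t^{2H}-|s-t|^{2H}\big)$ for $s,t\ge 0$. Let $\mathcal E$ be the space of simple functions $f=\sum_{i} x_i\mathbb 1_{[0,s_i)}$ on $[0,T]$ (finite sums, $x_i\in X$, $s_i\in(0,T]$), equipped with the scalar product $$\Big\langle \sum_i x_i\mathbb 1_{[0,s_i)},\ \sum_j y_j\mathbb 1_{[0,t_j)}\Big\rangle_{\mathcal M}=\sum_{i}\sum_j [x_i,y_j]\,R(s_i,t_j),$$ and let $\mathcal M$ be the completion of $\mathcal E$ with respect to $\langle\cdot,\cdot\rangle_{\mathcal M}$ (the space of $X$-valued integrands for fractional Brownian motion with Hurst parameter $H$). For $\alpha>0$ and $\varphi\in L^2([0,T];X)$ let $$(I^\alpha_{T-}\varphi)(t)=\frac1{\Gamma(\alpha)}\int_t^T (s-t)^{\alpha-1}\varphi(s)\,ds,$$ and let $H^{\alpha}_{T-}([0,T];X)=I^\alpha_{T-}\big(L^2([0,T];X)\big)$ with norm $\|I^\alpha_{T-}\varphi\|_{H^\alpha_{T-}}=\|\varphi\|_{L^2}$.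 Then the spaces $\mathcal M$ and $H^{1/2-H}_{T-}([0,T];X)$ coincide and their norms are equivalent. Precisely: the inclusion of $\mathcal E$ into $L^2([0,T];X)$ extends to a continuous linear injection $J:\mathcal M\to L^2([0,T];X)$ whose range is exactly $H^{1/2-H}_{T-}([0,T];X)$, and there are constants $c,C>0$ such that, for all $m\in\mathcal M$ and all $\varphi\in L^2([0,T];X)$ with $J m=I^{1/2-H}_{T-}\varphi$, $$c\,\|\varphi\|_{L^2}\le \|m\|_{\mathcal M}\le C\,\|\varphi\|_{L^2}.$$ -/

import Mathlib

open MeasureTheory Set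
open scoped ENNReal

noncomputable section

/-- The covariance function `R(s,t) = (s^{2H} + t^{2H} - |s-t|^{2H}) / 2` (for `s, t ≥ 0`) of a
standard real fractional Brownian motion with Hurst parameter `H`. -/
def fbmCov (H s t : ℝ) : ℝ :=
  (s ^ (2 * H) + t ^ (2 * H) - |s - t| ^ (2 * H)) / 2

lemma fbmCov_comm (H s t : ℝ) : fbmCov H s t = fbmCov H t s := by
  unfold fbmCov; rw [abs_sub_comm]; ring

/-! ### Positive semidefiniteness of the covariance function -/

/-- The weight `u ^ (-1-2H)` against which `1 - cos (s u)` integrates to a multiple of `s ^ 2H`. -/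
def cosWeight (H u : ℝ) : ℝ := u ^ (-1 - 2 * H)

/-- The normalising constant `∫₀^∞ (1 - cos u) u^{-1-2H} du`. -/
def cosConst (H : ℝ) : ℝ := ∫ u in Ioi (0 : ℝ), (1 - Real.cos u) * cosWeight H u

lemma integrableOn_cosWeight {H : ℝ} (h0 : 0 < H) (h1 : H < 1) (s : ℝ) :
    IntegrableOn (fun u => (1 - Real.cos (s * u)) * cosWeight H u) (Ioi (0 : ℝ)) := by
  have hmeas : Measurable (fun u => (1 - Real.cos (s * u)) * cosWeight H u) := by
    unfold cosWeight; fun_prop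
  rw [← Ioc_union_Ioi_eq_Ioi (zero_le_one' ℝ)]
  refine IntegrableOn.union ?_ ?_
  · have hi : IntegrableOn (fun u : ℝ => s ^ 2 / 2 * u ^ (1 - 2 * H)) (Ioc 0 1) := by
      have := (intervalIntegral.intervalIntegrable_rpow' (r := 1 - 2 * H) (a := 0) (b := 1)
        (by linarith)).const_mul (s ^ 2 / 2)
      rwa [intervalIntegrable_iff_integrableOn_Ioc_of_le zero_le_one] at this
    refine hi.mono' hmeas.aestronglyMeasurable ?_
    refine (ae_restrict_iff' measurableSet_Ioc).2 (.of_forall fun u hu => ?_)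
    have hu0 : 0 < u := hu.1
    have hw : 0 ≤ cosWeight H u := Real.rpow_nonneg hu0.le _
    rw [Real.norm_eq_abs, abs_of_nonneg
      (mul_nonneg (by linarith [Real.cos_le_one (s * u)]) hw)]
    have hb : 1 - Real.cos (s * u) ≤ (s * u) ^ 2 / 2 := by
      linarith [Real.one_sub_sq_div_two_le_cos (x := s * u)]
    calc (1 - Real.cos (s * u)) * cosWeight H u ≤ (s * u) ^ 2 / 2 * cosWeight H u := by gcongr
      _ = s ^ 2 / 2 * (u ^ (2 : ℝ) * u ^ (-1 - 2 * H)) := by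
          unfold cosWeight; rw [Real.rpow_two]; ring
      _ = s ^ 2 / 2 * u ^ (1 - 2 * H) := by
          rw [← Real.rpow_add hu0]; ring_nf
  · have hi : IntegrableOn (fun u : ℝ => 2 * u ^ (-1 - 2 * H)) (Ioi 1) :=
      (integrableOn_Ioi_rpow_of_lt (by linarith) one_pos).const_mul 2
    refine hi.mono' hmeas.aestronglyMeasurable ?_
    refine (ae_restrict_iff' measurableSet_Ioi).2 (.of_forall fun u hu => ?_)
    have hw : 0 ≤ cosWeight H u := Real.rpow_nonneg (zero_le_one.trans (le_of_lt hu)) _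
    rw [Real.norm_eq_abs, abs_of_nonneg
      (mul_nonneg (by linarith [Real.cos_le_one (s * u)]) hw)]
    have : 1 - Real.cos (s * u) ≤ 2 := by linarith [Real.neg_one_le_cos (s * u)]
    exact mul_le_mul_of_nonneg_right this hw

lemma cosConst_pos {H : ℝ} (h0 : 0 < H) (h1 : H < 1) : 0 < cosConst H := by
  have hi : IntegrableOn (fun u => (1 - Real.cos u) * cosWeight H u) (Ioi (0 : ℝ)) := by
    simpa using integrableOn_cosWeight h0 h1 1
  have hnn : ∀ u ∈ Ioi (0 : ℝ), 0 ≤ (1 - Real.cos u) * cosWeight H u := fun u hu =>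
    mul_nonneg (by linarith [Real.cos_le_one u]) (Real.rpow_nonneg (le_of_lt hu) _)
  unfold cosConst
  rw [setIntegral_pos_iff_support_of_nonneg_ae
    ((ae_restrict_iff' measurableSet_Ioi).2 (.of_forall hnn)) hi]
  refine lt_of_lt_of_le ?_ (measure_mono (s := Ioo (0 : ℝ) 1) ?_)
  · simp
  · intro u hu
    refine ⟨?_, hu.1⟩
    have hc : Real.cos u < 1 := by
      rw [← Real.cos_zero]
      exact Real.cos_lt_cos_of_nonneg_of_le_pi le_rfl
        (by linarith [hu.2, Real.pi_gt_three]) hu.1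
    exact mul_ne_zero (by linarith) (Real.rpow_pos_of_pos hu.1 _).ne'

lemma integral_cosWeight (H : ℝ) (h0 : 0 < H) {s : ℝ} (hs : 0 ≤ s) :
    ∫ u in Ioi (0 : ℝ), (1 - Real.cos (s * u)) * cosWeight H u = s ^ (2 * H) * cosConst H := by
  rcases hs.eq_or_lt with rfl | hs
  · simp [Real.zero_rpow (by positivity : 2 * H ≠ 0)]
  · have := integral_comp_mul_left_Ioi
      (fun u => (1 - Real.cos u) * cosWeight H u) 0 hs
    rw [mul_zero] at this
    have hc : ∀ u ∈ Ioi (0 : ℝ), (1 - Real.cos (s * u)) * cosWeight H u =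
        s ^ (1 + 2 * H) * ((1 - Real.cos (s * u)) * cosWeight H (s * u)) := by
      intro u hu
      unfold cosWeight
      rw [Real.mul_rpow hs.le (le_of_lt hu)]
      have : s ^ (1 + 2 * H) * s ^ (-1 - 2 * H) = 1 := by
        rw [← Real.rpow_add hs]; ring_nf; simp
      linear_combination (-(1 - Real.cos (s * u)) * u ^ (-1 - 2 * H)) * this
    rw [setIntegral_congr_fun measurableSet_Ioi hc, integral_const_mul, this]
    rw [smul_eq_mul, ← mul_assoc, Real.rpow_add hs, Real.rpow_one]
    unfold cosConst
    field_simp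

lemma fbmCov_spectral {H : ℝ} (h0 : 0 < H) (h1 : H < 1) {s t : ℝ} (hs : 0 ≤ s) (ht : 0 ≤ t) :
    IntegrableOn (fun u => ((1 - Real.cos (s * u)) * (1 - Real.cos (t * u))
      + Real.sin (s * u) * Real.sin (t * u)) * cosWeight H u) (Ioi (0 : ℝ)) ∧
    ∫ u in Ioi (0 : ℝ), ((1 - Real.cos (s * u)) * (1 - Real.cos (t * u))
      + Real.sin (s * u) * Real.sin (t * u)) * cosWeight H u
      = 2 * cosConst H * fbmCov H s t := by
  have hfun : (fun u => ((1 - Real.cos (s * u)) * (1 - Real.cos (t * u))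
      + Real.sin (s * u) * Real.sin (t * u)) * cosWeight H u) = fun u =>
      (1 - Real.cos (s * u)) * cosWeight H u + (1 - Real.cos (t * u)) * cosWeight H u
        - (1 - Real.cos (|s - t| * u)) * cosWeight H u := by
    funext u
    have : Real.cos (|s - t| * u) =
        Real.cos (s * u) * Real.cos (t * u) + Real.sin (s * u) * Real.sin (t * u) := by
      rw [← Real.cos_sub, ← sub_mul]
      rcases abs_choice (s - t) with h | h <;> rw [h]
      rw [neg_mul, Real.cos_neg]
    rw [this]; ring
  have is := integrableOn_cosWeight h0 h1 s
  have it := integrableOn_cosWeight h0 h1 t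
  have id := integrableOn_cosWeight h0 h1 |s - t|
  rw [hfun]
  refine ⟨(is.add it).sub id, ?_⟩
  have e1 := integral_sub (is.add it) id
  have e2 := integral_add is it
  simp only [Pi.add_apply] at e1
  rw [e1, e2, integral_cosWeight H h0 hs, integral_cosWeight H h0 ht,
    integral_cosWeight H h0 (abs_nonneg _)]
  unfold fbmCov
  ring

lemma fbmCov_psd {X : Type*} [NormedAddCommGroup X] [InnerProductSpace ℝ X] {H : ℝ}
    (h0 : 0 < H) (h1 : H < 1) {ι : Type*} (I : Finset ι) (s : ι → ℝ) (hs : ∀ i, 0 ≤ s i)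
    (x : ι → X) :
    0 ≤ ∑ i ∈ I, ∑ j ∈ I, inner ℝ (x i) (x j) * fbmCov H (s i) (s j) := by
  have hC := cosConst_pos h0 h1
  suffices h : 0 ≤ 2 * cosConst H *
      ∑ i ∈ I, ∑ j ∈ I, inner ℝ (x i) (x j) * fbmCov H (s i) (s j) from
    nonneg_of_mul_nonneg_right h (by positivity)
  have key : 2 * cosConst H * ∑ i ∈ I, ∑ j ∈ I, inner ℝ (x i) (x j) * fbmCov H (s i) (s j) =
      ∫ u in Ioi (0 : ℝ), ∑ i ∈ I, ∑ j ∈ I, inner ℝ (x i) (x j) *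
        (((1 - Real.cos (s i * u)) * (1 - Real.cos (s j * u))
          + Real.sin (s i * u) * Real.sin (s j * u)) * cosWeight H u) := by
    rw [integral_finsetSum _ fun i _ => integrable_finsetSum _ fun j _ =>
      ((fbmCov_spectral h0 h1 (hs i) (hs j)).1.const_mul _), Finset.mul_sum]
    refine Finset.sum_congr rfl fun i _ => ?_
    rw [integral_finsetSum _ fun j _ =>
      ((fbmCov_spectral h0 h1 (hs i) (hs j)).1.const_mul _), Finset.mul_sum]
    refine Finset.sum_congr rfl fun j _ => ?_
    rw [integral_const_mul, (fbmCov_spectral h0 h1 (hs i) (hs j)).2]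
    ring
  rw [key]
  refine setIntegral_nonneg measurableSet_Ioi fun u hu => ?_
  have hw : 0 ≤ cosWeight H u := Real.rpow_nonneg (le_of_lt hu) _
  have : ∑ i ∈ I, ∑ j ∈ I, inner ℝ (x i) (x j) *
        (((1 - Real.cos (s i * u)) * (1 - Real.cos (s j * u))
          + Real.sin (s i * u) * Real.sin (s j * u)) * cosWeight H u) =
      (inner ℝ (∑ i ∈ I, (1 - Real.cos (s i * u)) • x i)
          (∑ i ∈ I, (1 - Real.cos (s i * u)) • x i)
        + inner ℝ (∑ i ∈ I, Real.sin (s i * u) • x i)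
          (∑ i ∈ I, Real.sin (s i * u) • x i)) * cosWeight H u := by
    simp only [sum_inner, inner_sum, real_inner_smul_left, real_inner_smul_right]
    rw [← Finset.sum_add_distrib, Finset.sum_mul]
    refine Finset.sum_congr rfl fun i _ => ?_
    rw [← Finset.sum_add_distrib, Finset.sum_mul]
    refine Finset.sum_congr rfl fun j _ => ?_
    rw [real_inner_comm (x i) (x j)]
    ring
  rw [this]
  exact mul_nonneg (add_nonneg real_inner_self_nonneg real_inner_self_nonneg) hw

/-! ### Simple functions -/

section Simple

variable (T : ℝ) (X : Type*) [NormedAddCommGroup X] [InnerProductSpace ℝ X]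

/-- A finite family of coefficients `x_s ∈ X`, `s ∈ (0,T]`, is sent to the step function
`∑ s, x_s 1_{[0,s)}` on `[0,T]` (extended by zero to `ℝ`). -/
def stepMap : (Ioc (0 : ℝ) T →₀ X) →ₗ[ℝ] (ℝ → X) :=
  Finsupp.lsum ℝ fun s : Ioc (0 : ℝ) T =>
    { toFun := fun x => (Ico (0 : ℝ) s).indicator fun _ => x
      map_add' := fun x y => Set.indicator_add _ (fun _ => x) (fun _ => y)
      map_smul' := fun c x => Set.indicator_const_smul _ c (fun _ => x) }

lemma stepMap_apply (c : Ioc (0 : ℝ) T →₀ X) (t : ℝ) :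
    stepMap T X c t = c.sum fun s x => (Ico (0 : ℝ) s).indicator (fun _ => x) t := by
  unfold stepMap
  rw [Finsupp.lsum_apply, Finsupp.sum, Finset.sum_apply]
  rfl

/-- The indicator functions `1_{[0,s)}`, `s ∈ (0,T]`, are linearly independent over `X`. -/
lemma stepMap_injective : Function.Injective (stepMap T X) := by
  rw [injective_iff_map_eq_zero]
  intro c hc
  by_contra hne
  have hS : c.support.Nonempty := Finsupp.support_nonempty_iff.2 hne
  obtain ⟨m, hm, hmax⟩ := c.support.exists_max_image id hS
  have hmax' : ∀ s ∈ c.support, (s : ℝ) ≤ m := fun s hs => hmax s hs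
  -- a point to the left of `m` and to the right of every other node
  obtain ⟨t, ht0, htm, ht⟩ : ∃ t : ℝ, 0 ≤ t ∧ t < m ∧ ∀ s ∈ c.support, s ≠ m → (s : ℝ) ≤ t := by
    rcases (c.support.erase m).eq_empty_or_nonempty with h | h
    · refine ⟨0, le_rfl, m.2.1, fun s hs hsm => ?_⟩
      have : s ∈ c.support.erase m := Finset.mem_erase.2 ⟨hsm, hs⟩
      rw [h] at this
      simp at this
    · obtain ⟨r, hr, hrmax⟩ := (c.support.erase m).exists_max_image id h
      have hr' := Finset.mem_erase.1 hr
      refine ⟨r, r.2.1.le, lt_of_le_of_ne (hmax' r hr'.2) fun h => hr'.1 (Subtype.ext h), ?_⟩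
      intro s hs hsm
      exact hrmax s (Finset.mem_erase.2 ⟨hsm, hs⟩)
  have hval := congrFun hc t
  rw [stepMap_apply, Finsupp.sum, Finset.sum_eq_single m] at hval
  · rw [Set.indicator_of_mem (show t ∈ Ico (0 : ℝ) m from ⟨ht0, htm⟩)] at hval
    exact (Finsupp.mem_support_iff.1 hm) hval
  · intro s hs hsm
    exact Set.indicator_of_notMem (fun h => absurd h.2 (not_lt.2 (ht s hs hsm))) _
  · intro h
    exact absurd hm h

/-- The space `ℰ` of simple functions `[0,T] → X`: the finite sums `∑ x_i 1_{[0,s_i)}` with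
`x_i ∈ X` and `s_i ∈ (0,T]` (equivalently, the functions `∑ x_i 1_{[t_i,t_{i+1})}` for partitions
`0 = t_0 < ⋯ < t_n = T`). The Hurst parameter `H` is recorded in the type because the inner
product put on `ℰ` below depends on it. -/
def SimpleFn (_H : Ioo (0 : ℝ) 1) : Type _ := LinearMap.range (stepMap T X)

end Simple

namespace SimpleFn

variable {T : ℝ} {X : Type*} [NormedAddCommGroup X] [InnerProductSpace ℝ X] {H : Ioo (0 : ℝ) 1}

instance : AddCommGroup (SimpleFn T X H) :=
  inferInstanceAs (AddCommGroup (LinearMap.range (stepMap T X)))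

instance : Module ℝ (SimpleFn T X H) :=
  inferInstanceAs (Module ℝ (LinearMap.range (stepMap T X)))

/-- The underlying function of a simple function. -/
def toFun (f : SimpleFn T X H) : ℝ → X := f.1

/-- The unique coefficients `x_s` with `f = ∑ s, x_s 1_{[0,s)}`. -/
def coeff : SimpleFn T X H ≃ₗ[ℝ] (Ioc (0 : ℝ) T →₀ X) :=
  (LinearEquiv.ofInjective (stepMap T X) (stepMap_injective T X)).symm

lemma stepMap_coeff (f : SimpleFn T X H) : stepMap T X (coeff f) = f.toFun :=
  congrArg Subtype.val
    ((LinearEquiv.ofInjective (stepMap T X) (stepMap_injective T X)).apply_symm_apply f)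

/-- `⟨∑ x_s 1_{[0,s)}, ∑ y_t 1_{[0,t)}⟩ = ∑ s, ∑ t, [x_s, y_t] R(s,t)`. -/
def innerM (f g : SimpleFn T X H) : ℝ :=
  (coeff f).sum fun s x => (coeff g).sum fun t y => inner ℝ x y * fbmCov H s t

lemma innerM_comm (f g : SimpleFn T X H) : innerM f g = innerM g f := by
  unfold innerM
  rw [Finsupp.sum_comm]
  simp only [real_inner_comm, fbmCov_comm]

/-- The scalar product of `ℰ`. -/
@[reducible] def core : PreInnerProductSpace.Core ℝ (SimpleFn T X H) where
  inner := innerM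
  conj_inner_symm f g := innerM_comm g f
  re_inner_nonneg f :=
    fbmCov_psd H.2.1 H.2.2 (coeff f).support (fun s => (s : ℝ)) (fun s => s.2.1.le) (coeff f)
  add_left f g h := by
    change innerM _ _ = innerM _ _ + innerM _ _
    unfold innerM
    rw [map_add, Finsupp.sum_add_index']
    · intro s; simp
    · intro s x y
      rw [← Finsupp.sum_add]
      simp only [inner_add_left, add_mul]
  smul_left f g r := by
    change innerM _ _ = r * innerM _ _
    unfold innerM
    rw [map_smul, Finsupp.sum_smul_index']
    · simp only [real_inner_smul_left, Finsupp.sum, Finset.mul_sum, mul_assoc]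
    · intro s; simp

instance : SeminormedAddCommGroup (SimpleFn T X H) :=
  @InnerProductSpace.Core.toSeminormedAddCommGroup ℝ (SimpleFn T X H) _ _ _ core

instance : InnerProductSpace ℝ (SimpleFn T X H) := InnerProductSpace.ofCore core

lemma inner_def (f g : SimpleFn T X H) : inner ℝ f g =
    (coeff f).sum fun s x => (coeff g).sum fun t y => inner ℝ x y * fbmCov H s t := rfl

end SimpleFn

/-- The space `𝓜` of integrands: the completion of the simple functions with respect to the
scalar product of `SimpleFn`. -/
abbrev FBmIntegrands (T : ℝ) (X : Type*) [NormedAddCommGroup X] [InnerProductSpace ℝ X]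
    (H : Ioo (0 : ℝ) 1) : Type _ :=
  UniformSpace.Completion (SimpleFn T X H)

/-! ### The fractional Sobolev-type space -/

/-- `L²([0,T]; X)` with respect to Lebesgue measure. -/
abbrev L2Interval (T : ℝ) (X : Type*) [NormedAddCommGroup X] : Type _ :=
  Lp X 2 ((volume : Measure ℝ).restrict (Icc 0 T))

section Frac

variable {X : Type*} [NormedAddCommGroup X] [InnerProductSpace ℝ X]

/-- The right-sided fractional integral
`(I^α_{T-} φ)(t) = Γ(α)⁻¹ ∫_t^T (s - t)^{α - 1} φ(s) ds`. -/
def fracIntegral (α T : ℝ) (φ : ℝ → X) (t : ℝ) : X :=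
  (Real.Gamma α)⁻¹ • ∫ s in Ioc t T, (s - t) ^ (α - 1) • φ s

/-- `g = I^α_{T-} φ` in `L²([0,T]; X)`. -/
def IsFracIntegral (α : ℝ) {T : ℝ} (φ g : L2Interval T X) : Prop :=
  (g : ℝ → X) =ᵐ[(volume : Measure ℝ).restrict (Icc 0 T)] fracIntegral α T φ

variable (X) in
/-- The space `H^α_{T-}([0,T]; X) = I^α_{T-}(L²([0,T]; X))`, as a subset of `L²([0,T]; X)`.
Its norm is given by `‖g‖ = ‖φ‖_{L²}` whenever `g = I^α_{T-} φ`. -/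
def fracSobolevSpace (α T : ℝ) : Set (L2Interval T X) :=
  {g | ∃ φ : L2Interval T X, IsFracIntegral α φ g}

end Frac

end

/-! Put `a = 1/2 - H`, so `0 < a < 1/2`. The moving-average kernel of Mandelbrot and Van Ness, `(s -
u)₊^(-a) - (-u)₊^(-a)`, has Gram matrix `mvnConst a * R(s,t)` in `L²(ℝ)` (`integral_mvnKernel_mul`).
Hence, up to a constant factor, the norm of `𝓜` is the `L²(ℝ)` norm of the moving-average integrand
`mvnSum` of a step function (`lintegral_mvnSum_sq`).

This integrand vanishes beyond `T`, and on `[0,T]` it is `Γ(1-a)` times the fractional derivative `D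
f` (`fracDeriv`). On the negative half-line it is an integral of `f` itself; writing `f = I^a D f`
there turns it into a kernel of degree `-1` acting on `D f`, which the Schur test bounds in `L²`
(`enorm_mvnSum_neg_le`, `lintegral_sq_hardy_le`). So the past contributes no more than a multiple of
`‖D f‖²`, and the norms of `f` in `𝓜` and of `D f` in `L²([0,T]; X)` are equivalent
(`exists_norm_fracDeriv_equiv`).

Therefore `D` extends to an operator `E` on `𝓜` that is bounded below. Its range is closed, and it
is dense because a function orthogonal to all `(s - ·)₊^(-a) x` has vanishing left-sided fractional
integral and is zero by Abel's argument (`eq_zero_of_forall_inner_fracDeriv`). Thus `E` is an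
isomorphism onto `L²`, and `J = I^a ∘ E`. Euler's beta integral gives `I^a D f = f` on step
functions (`fracIntegral_fracDeriv`), Abel's argument gives injectivity of `I^a`
(`IsFracIntegral.unique`), and the range of `J` is that of `I^a`. -/

noncomputable section

/-! ### Truncated powers -/

/-- The truncated power `x₊ ^ e`, which vanishes on `(-∞, 0]` when `e ≠ 0`. -/
def posPow (e x : ℝ) : ℝ := (max x 0) ^ e

lemma posPow_of_pos (e : ℝ) {x : ℝ} (hx : 0 < x) : posPow e x = x ^ e := by
  rw [posPow, max_eq_left hx.le]

lemma posPow_of_nonpos {e : ℝ} (he : e ≠ 0) {x : ℝ} (hx : x ≤ 0) : posPow e x = 0 := by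
  rw [posPow, max_eq_right hx, Real.zero_rpow he]

lemma posPow_nonneg (e x : ℝ) : 0 ≤ posPow e x :=
  Real.rpow_nonneg (le_max_right _ _) _

@[fun_prop]
lemma measurable_posPow (e : ℝ) : Measurable (posPow e) := by
  unfold posPow; fun_prop

lemma posPow_mul (e : ℝ) {c : ℝ} (hc : 0 < c) (x : ℝ) :
    posPow e (c * x) = c ^ e * posPow e x := by
  unfold posPow
  rw [← Real.mul_rpow hc.le (le_max_right _ _), mul_max_of_nonneg _ _ hc.le, mul_zero]

/-- With parameters `β` and `1 - β` the normalising factor `Γ(β + (1 - β))` is `1`. Euler's integral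
can then be read off from the total mass of the beta distribution. -/
lemma betaPDF_eq_posPow {β : ℝ} (h0 : 0 < β) (h1 : β < 1) (x : ℝ) :
    ProbabilityTheory.betaPDFReal β (1 - β) x =
      (Real.Gamma β * Real.Gamma (1 - β))⁻¹ * (posPow (β - 1) x * posPow (-β) (1 - x)) := by
  unfold ProbabilityTheory.betaPDFReal ProbabilityTheory.beta
  split_ifs with h
  · rw [posPow_of_pos _ h.1, posPow_of_pos _ (by linarith [h.2] : 0 < 1 - x)]
    simp only [add_sub_cancel, Real.Gamma_one, div_one, one_div]
    rw [show 1 - β - 1 = -β by ring, mul_assoc]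
  · rcases not_and_or.1 h with h | h
    · rw [posPow_of_nonpos (by linarith) (not_lt.1 h)]; simp
    · rw [posPow_of_nonpos (e := -β) (by linarith) (by linarith [not_lt.1 h])]; simp

lemma integrable_posPow_mul_one {β : ℝ} (h0 : 0 < β) (h1 : β < 1) :
    Integrable (fun x => posPow (β - 1) x * posPow (-β) (1 - x)) ∧
      ∫ x, posPow (β - 1) x * posPow (-β) (1 - x) = Real.Gamma β * Real.Gamma (1 - β) := by
  have hG : 0 < Real.Gamma β * Real.Gamma (1 - β) :=
    mul_pos (Real.Gamma_pos_of_pos h0) (Real.Gamma_pos_of_pos (by linarith))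
  have hnn : ∀ x, 0 ≤ posPow (β - 1) x * posPow (-β) (1 - x) := fun x =>
    mul_nonneg (posPow_nonneg _ _) (posPow_nonneg _ _)
  have hm : Measurable fun x => posPow (β - 1) x * posPow (-β) (1 - x) := by fun_prop
  have key : ∫⁻ x, ENNReal.ofReal (posPow (β - 1) x * posPow (-β) (1 - x)) =
      ENNReal.ofReal (Real.Gamma β * Real.Gamma (1 - β)) := by
    have h := ProbabilityTheory.lintegral_betaPDF_eq_one h0 (by linarith : 0 < 1 - β)
    simp_rw [ProbabilityTheory.betaPDF, betaPDF_eq_posPow h0 h1,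
      ENNReal.ofReal_mul (inv_nonneg.2 hG.le)] at h
    rw [lintegral_const_mul _ hm.ennreal_ofReal, ENNReal.ofReal_inv_of_pos hG] at h
    rw [← ENNReal.div_eq_inv_mul, ENNReal.div_eq_one_iff (by simpa using hG)
      ENNReal.ofReal_ne_top] at h
    exact h
  refine ⟨⟨hm.aestronglyMeasurable, ?_⟩, ?_⟩
  · rw [hasFiniteIntegral_iff_ofReal (.of_forall hnn), key]; exact ENNReal.ofReal_lt_top
  · rw [integral_eq_lintegral_of_nonneg_ae (.of_forall hnn) hm.aestronglyMeasurable, key,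
      ENNReal.toReal_ofReal hG.le]

/-- Euler's beta integral in convolution form. -/
lemma integrable_posPow_mul {β : ℝ} (h0 : 0 < β) (h1 : β < 1) (a b : ℝ) :
    Integrable (fun u => posPow (β - 1) (u - a) * posPow (-β) (b - u)) ∧
      ∫ u, posPow (β - 1) (u - a) * posPow (-β) (b - u) =
        if a < b then Real.Gamma β * Real.Gamma (1 - β) else 0 := by
  split_ifs with hab
  · have hc : 0 < b - a := sub_pos.2 hab
    have hci : 0 < (b - a)⁻¹ := inv_pos.2 hc
    -- Substitution `x = (u - a)/(b - a)`. The powers of `b - a` cancel because `(β - 1) + (-β) + 1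
    -- = 0`, so the integral does not depend on `a` and `b`.
    have hfun : (fun u => posPow (β - 1) (u - a) * posPow (-β) (b - u)) = fun u =>
        (b - a)⁻¹ * ((fun x => posPow (β - 1) ((b - a)⁻¹ * x) *
          posPow (-β) (1 - (b - a)⁻¹ * x)) (u - a)) := by
      funext u
      have e1 : 1 - (b - a)⁻¹ * (u - a) = (b - a)⁻¹ * (b - u) := by field_simp; ring
      simp only [e1, posPow_mul _ hci]
      have e2 : (b - a)⁻¹ * ((b - a)⁻¹ ^ (β - 1) * (b - a)⁻¹ ^ (-β)) = 1 := by
        rw [← Real.rpow_add hci]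
        nth_rw 1 [← Real.rpow_one (b - a)⁻¹]
        rw [← Real.rpow_add hci]; ring_nf; simp
      linear_combination (-(posPow (β - 1) (u - a) * posPow (-β) (b - u))) * e2
    obtain ⟨hi, he⟩ := integrable_posPow_mul_one h0 h1
    rw [hfun]
    refine ⟨((hi.comp_mul_left' hci.ne').comp_sub_right a).const_mul _, ?_⟩
    rw [integral_const_mul, integral_sub_right_eq_self (fun x => posPow (β - 1) ((b - a)⁻¹ * x) *
          posPow (-β) (1 - (b - a)⁻¹ * x)) a,
      Measure.integral_comp_mul_left (fun x => posPow (β - 1) x * posPow (-β) (1 - x)), he,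
      inv_inv, abs_of_pos hc, smul_eq_mul, inv_mul_cancel_left₀ hc.ne']
  · have : (fun u => posPow (β - 1) (u - a) * posPow (-β) (b - u)) = fun _ => 0 := by
      funext u
      rcases le_total u a with h | h
      · rw [posPow_of_nonpos (by linarith) (by linarith), zero_mul]
      · rw [posPow_of_nonpos (e := -β) (by linarith) (by linarith), mul_zero]
    rw [this]; simp

/-! ### The Schur test -/

/-- The Schur test for a nonnegative kernel. -/
lemma lintegral_sq_kernel_le {α β : Type*} [MeasurableSpace α] [MeasurableSpace β]
    (μ : Measure α) (ν : Measure β) [SFinite μ] [SFinite ν] {k : α → β → ℝ≥0∞}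
    (hk : Measurable (Function.uncurry k)) {w : β → ℝ≥0∞} {w' : α → ℝ≥0∞} (hw : Measurable w)
    (hw' : Measurable w') (hw0 : ∀ᵐ y ∂ν, w y ≠ 0 ∧ w y ≠ ∞) {C₁ C₂ : ℝ≥0∞}
    (h₁ : ∀ᵐ x ∂μ, ∫⁻ y, k x y * w y ∂ν ≤ C₁ * w' x)
    (h₂ : ∀ᵐ y ∂ν, ∫⁻ x, k x y * w' x ∂μ ≤ C₂ * w y) {f : β → ℝ≥0∞} (hf : Measurable f) :
    ∫⁻ x, (∫⁻ y, k x y * f y ∂ν) ^ 2 ∂μ ≤ C₁ * C₂ * ∫⁻ y, f y ^ 2 ∂ν := by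
  have hkx : ∀ x, Measurable (k x) := fun x => hk.comp measurable_prodMk_left
  have hky : ∀ y, Measurable (fun x => k x y) := fun y => hk.comp measurable_prodMk_right
  have hm : Measurable (Function.uncurry fun x y => w' x * (k x y * (f y ^ 2 / w y))) :=
    (hw'.comp measurable_fst).mul (hk.mul
      (((hf.comp measurable_snd).pow_const 2).div (hw.comp measurable_snd)))
  have e : ∀ z : ℝ≥0∞, (z ^ (1 / 2 : ℝ)) ^ (2 : ℝ) = z := fun z => by
    rw [← ENNReal.rpow_mul]; norm_num
  -- Cauchy–Schwarz for the splitting `k f = (k w)^(1/2) (k f² / w)^(1/2)`, legitimate where `w` is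
  -- neither `0` nor `∞`.
  have cs : ∀ x, (∫⁻ y, k x y * f y ∂ν) ^ 2 ≤
      (∫⁻ y, k x y * w y ∂ν) * ∫⁻ y, k x y * (f y ^ 2 / w y) ∂ν := by
    intro x
    have hkx' := hkx x
    have h := ENNReal.lintegral_mul_le_Lp_mul_Lq ν Real.HolderConjugate.two_two
      (f := fun y => (k x y * w y) ^ (1 / 2 : ℝ))
      (g := fun y => (k x y * (f y ^ 2 / w y)) ^ (1 / 2 : ℝ))
      (by fun_prop) (by fun_prop)
    simp only [Pi.mul_apply, e] at h
    have h' : ∫⁻ y, k x y * f y ∂ν = ∫⁻ y, (k x y * w y) ^ (1 / 2 : ℝ) *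
        (k x y * (f y ^ 2 / w y)) ^ (1 / 2 : ℝ) ∂ν := by
      refine lintegral_congr_ae ?_
      filter_upwards [hw0] with y hy
      rw [← ENNReal.mul_rpow_of_nonneg _ _ (by norm_num),
        show k x y * w y * (k x y * (f y ^ 2 / w y)) = (k x y * f y) ^ (2 : ℝ) by
          rw [ENNReal.rpow_two, div_eq_mul_inv,
            show k x y * w y * (k x y * (f y ^ 2 * (w y)⁻¹)) =
              (k x y * f y) ^ 2 * (w y * (w y)⁻¹) by ring,
            ENNReal.mul_inv_cancel hy.1 hy.2, mul_one],
        ← ENNReal.rpow_mul]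
      norm_num
    rw [h', ← e ((∫⁻ y, k x y * w y ∂ν) * _), ENNReal.mul_rpow_of_nonneg _ _ (by norm_num),
      ← ENNReal.rpow_two]
    exact ENNReal.rpow_le_rpow h (by norm_num)
  calc ∫⁻ x, (∫⁻ y, k x y * f y ∂ν) ^ 2 ∂μ
      ≤ ∫⁻ x, C₁ * ∫⁻ y, w' x * (k x y * (f y ^ 2 / w y)) ∂ν ∂μ := by
        refine lintegral_mono_ae ?_
        filter_upwards [h₁] with x hx
        have hkx' := hkx x
        refine (cs x).trans ((mul_le_mul_left hx _).trans_eq ?_)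
        rw [lintegral_const_mul _ (by fun_prop), mul_assoc]
    _ = C₁ * ∫⁻ x, ∫⁻ y, w' x * (k x y * (f y ^ 2 / w y)) ∂ν ∂μ :=
        lintegral_const_mul _ hm.lintegral_prod_right'
    _ = C₁ * ∫⁻ y, ∫⁻ x, w' x * (k x y * (f y ^ 2 / w y)) ∂μ ∂ν := by
        rw [lintegral_lintegral_swap hm.aemeasurable]
    _ ≤ C₁ * ∫⁻ y, C₂ * f y ^ 2 ∂ν := by
        gcongr 1
        refine lintegral_mono_ae ?_
        filter_upwards [h₂, hw0] with y hy hy0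
        have hky' := hky y
        calc ∫⁻ x, w' x * (k x y * (f y ^ 2 / w y)) ∂μ
            = (∫⁻ x, k x y * w' x ∂μ) * (f y ^ 2 / w y) := by
              rw [← lintegral_mul_const _ (by fun_prop)]
              congr 1; funext x; ring
          _ ≤ C₂ * w y * (f y ^ 2 / w y) := by gcongr
          _ = C₂ * f y ^ 2 := by
              rw [mul_assoc, ENNReal.mul_div_cancel hy0.1 hy0.2]
    _ = C₁ * C₂ * ∫⁻ y, f y ^ 2 ∂ν := by
        rw [lintegral_const_mul _ (hf.pow_const 2), mul_assoc]


/-! ### The fractional integral on `L²` -/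

lemma integrableOn_posPow {e : ℝ} (h1 : -1 < e) (h0 : e < 0) (a b : ℝ) :
    IntegrableOn (posPow e) (Icc a b) := by
  rcases le_or_gt b 0 with hb | hb
  · exact IntegrableOn.congr_fun (f := fun _ => 0) integrableOn_zero
      (fun x hx => (posPow_of_nonpos h0.ne (hx.2.trans hb)).symm) measurableSet_Icc
  · have hi : IntegrableOn (posPow e) (Ioc 0 b) := by
      have := intervalIntegral.intervalIntegrable_rpow' (a := 0) (b := b) h1
      rw [intervalIntegrable_iff_integrableOn_Ioc_of_le hb.le] at this
      exact this.congr_fun (fun x hx => (posPow_of_pos e hx.1).symm) measurableSet_Ioc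
    have hz : IntegrableOn (posPow e) (Iic 0) :=
      IntegrableOn.congr_fun (f := fun _ => 0) integrableOn_zero
        (fun x hx => (posPow_of_nonpos h0.ne hx).symm) measurableSet_Iic
    exact (hz.union hi).mono_set fun x hx =>
      (le_or_gt x 0).imp id fun h => ⟨h, hx.2⟩

/-- The `L¹` norm of `x₊ ^ e` on `[-T, T]`. -/
def posPowMass (e T : ℝ) : ℝ≥0∞ := ∫⁻ x in Icc (-T) T, ENNReal.ofReal (posPow e x)

lemma posPowMass_lt_top {e : ℝ} (h1 : -1 < e) (h0 : e < 0) (T : ℝ) : posPowMass e T < ∞ := by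
  have := (integrableOn_posPow h1 h0 (-T) T).hasFiniteIntegral
  rwa [hasFiniteIntegral_iff_ofReal (.of_forall (posPow_nonneg e))] at this

lemma lintegral_posPow_sub_right_le (e : ℝ) {T t : ℝ} (ht : t ∈ Icc 0 T) :
    ∫⁻ s in Icc 0 T, ENNReal.ofReal (posPow e (s - t)) ≤ posPowMass e T := by
  unfold posPowMass
  rw [← lintegral_indicator measurableSet_Icc, ← lintegral_indicator measurableSet_Icc,
    ← lintegral_sub_right_eq_self ((Icc (-T) T).indicator _) t]
  refine lintegral_mono fun s => ?_
  by_cases hs : s ∈ Icc 0 T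
  · rw [indicator_of_mem hs, indicator_of_mem (s := Icc (-T) T)
      ⟨by linarith [hs.1, ht.2], by linarith [hs.2, ht.1]⟩]
  · rw [indicator_of_notMem hs]; exact zero_le

lemma lintegral_posPow_sub_left_le (e : ℝ) {T s : ℝ} (hs : s ∈ Icc 0 T) :
    ∫⁻ t in Icc 0 T, ENNReal.ofReal (posPow e (s - t)) ≤ posPowMass e T := by
  unfold posPowMass
  rw [← lintegral_indicator measurableSet_Icc, ← lintegral_indicator measurableSet_Icc,
    ← lintegral_sub_left_eq_self ((Icc (-T) T).indicator _) s]
  refine lintegral_mono fun t => ?_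
  by_cases ht : t ∈ Icc 0 T
  · rw [indicator_of_mem ht, indicator_of_mem (s := Icc (-T) T)
      ⟨by linarith [hs.1, ht.2], by linarith [hs.2, ht.1]⟩]
  · rw [indicator_of_notMem ht]; exact zero_le

/-- Young's inequality for convolution with an `L¹` kernel, obtained from the Schur test with both
weights equal to `1`. -/
lemma lintegral_sq_posPow_le (e T : ℝ) {f : ℝ → ℝ≥0∞} (hf : Measurable f) :
    ∫⁻ t in Icc 0 T, (∫⁻ s in Icc 0 T, ENNReal.ofReal (posPow e (s - t)) * f s) ^ 2 ≤
      posPowMass e T * posPowMass e T * ∫⁻ s in Icc 0 T, f s ^ 2 := by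
  refine lintegral_sq_kernel_le (volume.restrict (Icc 0 T)) (volume.restrict (Icc 0 T))
    (k := fun t s => ENNReal.ofReal (posPow e (s - t))) (w := fun _ => 1) (w' := fun _ => 1)
    ?_ (by fun_prop) (by fun_prop) (.of_forall fun _ => by simp) ?_ ?_ hf
  · exact ((measurable_posPow e).comp (measurable_snd.sub measurable_fst)).ennreal_ofReal
  · refine (ae_restrict_iff' measurableSet_Icc).2 (.of_forall fun t ht => ?_)
    simpa using lintegral_posPow_sub_right_le e ht
  · refine (ae_restrict_iff' measurableSet_Icc).2 (.of_forall fun s hs => ?_)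
    simpa using lintegral_posPow_sub_left_le e hs

lemma enorm_Lp_sq {α E : Type*} [MeasurableSpace α] {μ : Measure α} [NormedAddCommGroup E]
    (f : Lp E 2 μ) : ‖f‖ₑ ^ 2 = ∫⁻ x, ‖f x‖ₑ ^ 2 ∂μ := by
  have := eLpNorm_nnreal_pow_eq_lintegral (μ := μ) (f := f) (p := 2) two_ne_zero
  rw [Lp.enorm_def]
  simpa using! this

section

variable {X : Type*} [NormedAddCommGroup X] [InnerProductSpace ℝ X]

/-- Since `α < 1`, the exponent `α - 1` is nonzero and the truncated power cuts off `s ≤ t` by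
itself. The domain of integration no longer depends on `t`, as the Schur test and Fubini require. -/
lemma fracIntegral_eq {α : ℝ} (h1 : α < 1) {T t : ℝ} (ht : 0 ≤ t) (φ : ℝ → X) :
    fracIntegral α T φ t =
      (Real.Gamma α)⁻¹ • ∫ s in Icc 0 T, posPow (α - 1) (s - t) • φ s := by
  unfold fracIntegral
  congr 1
  have : (fun s => posPow (α - 1) (s - t) • φ s) =
      (Ioi t).indicator fun s => (s - t) ^ (α - 1) • φ s := by
    funext s
    by_cases hs : t < s
    · rw [indicator_of_mem (show s ∈ Ioi t from hs), posPow_of_pos _ (sub_pos.2 hs)]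
    · rw [indicator_of_notMem (show s ∉ Ioi t from hs),
        posPow_of_nonpos (by linarith) (by linarith), zero_smul]
  rw [this, setIntegral_indicator measurableSet_Ioi]
  congr 2
  ext s
  simp only [mem_Ioc, mem_inter_iff, mem_Icc, mem_Ioi]
  exact ⟨fun h => ⟨⟨by linarith, h.2⟩, h.1⟩, fun h => ⟨h.2, h.1.2⟩⟩

lemma enorm_integral_posPow_le (e T t : ℝ) (φ : ℝ → X) :
    ‖∫ s in Icc 0 T, posPow e (s - t) • φ s‖ₑ ≤
      ∫⁻ s in Icc 0 T, ENNReal.ofReal (posPow e (s - t)) * ‖φ s‖ₑ := by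
  refine (enorm_integral_le_lintegral_enorm _).trans_eq ?_
  congr 1; funext s
  rw [enorm_smul, Real.enorm_of_nonneg (posPow_nonneg _ _)]

lemma aestronglyMeasurable_integral_posPow (e T : ℝ) {φ : ℝ → X} (hφ : StronglyMeasurable φ) :
    AEStronglyMeasurable (fun t => ∫ s in Icc 0 T, posPow e (s - t) • φ s)
      (volume.restrict (Icc 0 T)) := by
  have : StronglyMeasurable (Function.uncurry fun t s => posPow e (s - t) • φ s) :=
    ((measurable_posPow e).comp (measurable_snd.sub measurable_fst)).stronglyMeasurable.smul
      (hφ.comp_measurable measurable_snd)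
  exact this.integral_prod_right.aestronglyMeasurable

/-- The integral of the norms is square integrable in `t` by the Schur bound, hence finite almost
everywhere. Additivity of the fractional integral on `L²` rests on this. -/
lemma ae_integrable_posPow_smul {e : ℝ} (h1 : -1 < e) (h0 : e < 0) (T : ℝ) (φ : L2Interval T X) :
    ∀ᵐ t ∂(volume.restrict (Icc 0 T)),
      Integrable (fun s => posPow e (s - t) • φ s) (volume.restrict (Icc 0 T)) := by
  have hφ : StronglyMeasurable φ := Lp.stronglyMeasurable φ
  have hM := posPowMass_lt_top h1 h0 T
  have hfin : ∫⁻ t in Icc 0 T,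
      (∫⁻ s in Icc 0 T, ENNReal.ofReal (posPow e (s - t)) * ‖φ s‖ₑ) ^ 2 ≠ ∞ := by
    refine ((lintegral_sq_posPow_le e T hφ.enorm).trans_lt ?_).ne
    rw [← enorm_Lp_sq]
    exact ENNReal.mul_lt_top (ENNReal.mul_lt_top hM hM) (ENNReal.pow_lt_top enorm_lt_top)
  have hm : Measurable (Function.uncurry fun t s =>
      ENNReal.ofReal (posPow e (s - t)) * ‖φ s‖ₑ) :=
    ((measurable_posPow e).comp (measurable_snd.sub measurable_fst)).ennreal_ofReal.mul
      (hφ.enorm.comp measurable_snd)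
  filter_upwards [ae_lt_top (hm.lintegral_prod_right'.pow_const 2) hfin] with t ht
  refine ⟨(((measurable_posPow e).comp
    (measurable_id.sub_const t)).stronglyMeasurable.smul hφ).aestronglyMeasurable, ?_⟩
  have ht' := (ENNReal.pow_lt_top_iff (n := 2)).1 ht
  refine lt_of_eq_of_lt ?_ (ht'.resolve_right two_ne_zero)
  congr 1; funext s
  rw [enorm_smul, Real.enorm_of_nonneg (posPow_nonneg _ _), Function.uncurry_apply_pair]

/-- The fractional integral is a bounded operator on `L²([0,T]; X)`. -/
lemma exists_fracIntegral_clm {α : ℝ} (h0 : 0 < α) (h1 : α < 1) (T : ℝ) :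
    ∃ I : L2Interval T X →L[ℝ] L2Interval T X, ∀ φ, IsFracIntegral α φ (I φ) := by
  set M := posPowMass (α - 1) T
  have hM : M < ∞ := posPowMass_lt_top (by linarith) (by linarith) T
  have hΓ : 0 < (Real.Gamma α)⁻¹ := inv_pos.2 (Real.Gamma_pos_of_pos h0)
  have hmem : ∀ φ : L2Interval T X, eLpNorm (fun t => (Real.Gamma α)⁻¹ •
      ∫ s in Icc 0 T, posPow (α - 1) (s - t) • φ s) 2 (volume.restrict (Icc 0 T)) ≤
      ENNReal.ofReal (Real.Gamma α)⁻¹ * M * ‖φ‖ₑ := by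
    intro φ
    rw [← ENNReal.pow_le_pow_left_iff two_ne_zero]
    have hsq := eLpNorm_nnreal_pow_eq_lintegral (μ := volume.restrict (Icc 0 T))
      (f := fun t => (Real.Gamma α)⁻¹ •
        ∫ s in Icc 0 T, posPow (α - 1) (s - t) • φ s) (p := 2) two_ne_zero
    simp only [NNReal.coe_ofNat, ENNReal.coe_ofNat, ENNReal.rpow_ofNat] at hsq
    rw [hsq]
    calc _ ≤ ∫⁻ t in Icc 0 T, ENNReal.ofReal (Real.Gamma α)⁻¹ ^ 2 *
          (∫⁻ s in Icc 0 T, ENNReal.ofReal (posPow (α - 1) (s - t)) * ‖φ s‖ₑ) ^ 2 := by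
          refine lintegral_mono fun t => ?_
          simp only
          rw [enorm_smul, Real.enorm_of_nonneg hΓ.le, mul_pow]
          gcongr
          exact enorm_integral_posPow_le _ _ _ _
      _ ≤ ENNReal.ofReal (Real.Gamma α)⁻¹ ^ 2 * (M * M * ‖φ‖ₑ ^ 2) := by
          rw [lintegral_const_mul' _ _ (by simp), enorm_Lp_sq]
          gcongr
          exact lintegral_sq_posPow_le _ _ (Lp.stronglyMeasurable φ).enorm
      _ = _ := by ring
  have hLp : ∀ φ : L2Interval T X, MemLp (fun t => (Real.Gamma α)⁻¹ •
      ∫ s in Icc 0 T, posPow (α - 1) (s - t) • φ s) 2 (volume.restrict (Icc 0 T)) := fun φ =>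
    ⟨(aestronglyMeasurable_integral_posPow _ _ (Lp.stronglyMeasurable φ)).const_smul _,
      (hmem φ).trans_lt (ENNReal.mul_lt_top (ENNReal.mul_lt_top ENNReal.ofReal_lt_top hM)
        enorm_lt_top)⟩
  let L : L2Interval T X →ₗ[ℝ] L2Interval T X :=
    { toFun := fun φ => (hLp φ).toLp
      map_add' := fun φ ψ => by
        rw [← MemLp.toLp_add, MemLp.toLp_eq_toLp_iff]
        filter_upwards [ae_integrable_posPow_smul (e := α - 1) (by linarith) (by linarith) T φ,
          ae_integrable_posPow_smul (e := α - 1) (by linarith) (by linarith) T ψ] with t h₁ h₂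
        simp only [Pi.add_apply]
        rw [← smul_add, ← integral_add h₁ h₂]
        congr 1
        refine integral_congr_ae ?_
        filter_upwards [Lp.coeFn_add φ ψ] with s hs
        rw [hs, Pi.add_apply, smul_add]
      map_smul' := fun c φ => by
        rw [RingHom.id_apply, ← MemLp.toLp_const_smul, MemLp.toLp_eq_toLp_iff]
        refine .of_forall fun t => ?_
        simp only [Pi.smul_apply]
        rw [smul_comm c, ← integral_smul c]
        refine congrArg _ ?_
        refine integral_congr_ae ?_
        filter_upwards [Lp.coeFn_smul c φ] with s hs
        rw [hs, Pi.smul_apply, smul_comm] }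
  refine ⟨L.mkContinuous (ENNReal.ofReal (Real.Gamma α)⁻¹ * M).toReal fun φ => ?_, fun φ => ?_⟩
  · change ‖(hLp φ).toLp‖ ≤ _
    rw [Lp.norm_toLp, ← toReal_enorm φ, ← ENNReal.toReal_mul]
    exact ENNReal.toReal_mono (ENNReal.mul_ne_top (ENNReal.mul_ne_top ENNReal.ofReal_ne_top hM.ne)
      enorm_ne_top) (hmem φ)
  · change ((hLp φ).toLp : ℝ → X) =ᵐ[_] _
    filter_upwards [(hLp φ).coeFn_toLp, ae_restrict_mem measurableSet_Icc] with t ht ht'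
    rw [ht, fracIntegral_eq h1 ht'.1]

/-! ### Injectivity of the fractional integral -/

/-- The primitive of `φ`, extended by zero, is identically zero, and Lebesgue's differentiation
theorem recovers `φ` from it almost everywhere. -/
lemma ae_eq_zero_of_integral_tail [CompleteSpace X] {T : ℝ} {φ : ℝ → X}
    (hφ : IntegrableOn φ (Icc 0 T))
    (h : ∀ a ∈ Icc 0 T, ∫ s in Icc 0 T, (Ioi a).indicator φ s = 0) :
    φ =ᵐ[volume.restrict (Icc 0 T)] 0 := by
  have hi : Integrable ((Icc 0 T).indicator φ) := hφ.integrable_indicator measurableSet_Icc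
  have hz : ∀ x, ∫ s in (0 : ℝ)..x, (Icc 0 T).indicator φ s = 0 := by
    have hall : ∀ a ∈ Icc 0 T, ∫ s in Ioi a, (Icc 0 T).indicator φ s = 0 := fun a ha => by
      rw [← h a ha, setIntegral_indicator measurableSet_Icc, setIntegral_indicator measurableSet_Ioi,
        inter_comm]
    intro x
    rcases lt_or_ge x 0 with hx | hx
    · rw [intervalIntegral.integral_symm, intervalIntegral.integral_of_le hx.le,
        integral_Ioc_eq_integral_Ioo, setIntegral_indicator measurableSet_Icc,
        show Ioo x 0 ∩ Icc 0 T = ∅ by ext s; simp; intros; linarith]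
      simp
    rcases lt_or_ge T x with hT | hT
    · rcases lt_or_ge T 0 with hT0 | hT0
      · rw [Icc_eq_empty (not_le.2 hT0)]; simp
      rw [intervalIntegral.integral_of_le hx, setIntegral_indicator measurableSet_Icc,
        show Ioc 0 x ∩ Icc 0 T = Ioi 0 ∩ Icc 0 T by ext s; simp; intros; linarith,
        ← setIntegral_indicator measurableSet_Icc, hall 0 ⟨le_rfl, hT0⟩]
    · have := intervalIntegral.integral_Ioi_sub_Ioi (f := (Icc 0 T).indicator φ) (μ := volume)
        (a := 0) (b := x) hi.integrableOn hx
      rw [hall 0 ⟨le_rfl, hx.trans hT⟩, hall x ⟨hx, hT⟩, sub_zero] at this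
      rw [← this]
  filter_upwards [ae_restrict_of_ae (_root_.LocallyIntegrable.ae_hasDerivAt_integral hi.locallyIntegrable),
    ae_restrict_mem measurableSet_Icc] with x hx hxT
  have h' := hx 0
  simp_rw [hz] at h'
  have := h'.unique (hasDerivAt_const x (0 : X))
  rwa [indicator_of_mem hxT] at this

/-- The integrand of the beta integral vanishes off `[a, s]`, which lies in `[0, T]`, so restricting
to `[0, T]` loses nothing. -/
lemma integrableOn_posPow_mul {β : ℝ} (h0 : 0 < β) (h1 : β < 1) {T a s : ℝ} (ha : 0 ≤ a)
    (hs : s ≤ T) :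
    IntegrableOn (fun t => posPow (-β) (t - a) * posPow (β - 1) (s - t)) (Icc 0 T) ∧
      ∫ t in Icc 0 T, posPow (-β) (t - a) * posPow (β - 1) (s - t) =
        if a < s then Real.Gamma (1 - β) * Real.Gamma β else 0 := by
  obtain ⟨hi, he⟩ := integrable_posPow_mul (β := 1 - β) (by linarith) (by linarith) a s
  simp only [show 1 - β - 1 = -β by ring, show -(1 - β) = β - 1 by ring, sub_sub_cancel] at hi he
  refine ⟨hi.integrableOn, ?_⟩
  rw [← he]
  refine setIntegral_eq_integral_of_forall_compl_eq_zero fun t ht => ?_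
  rcases lt_or_ge t 0 with h | h
  · rw [posPow_of_nonpos (by linarith) (by linarith), zero_mul]
  · have : T < t := not_le.1 fun h' => ht ⟨h, h'⟩
    rw [posPow_of_nonpos (e := β - 1) (by linarith) (by linarith), mul_zero]

/-- Abel's argument: a function is determined by its right-sided fractional integral. -/
lemma ae_eq_zero_of_integral_posPow [CompleteSpace X] {β : ℝ} (h0 : 0 < β) (h1 : β < 1) {T : ℝ}
    {φ : ℝ → X} (hφ : IntegrableOn φ (Icc 0 T))
    (h : ∀ᵐ t ∂(volume.restrict (Icc 0 T)),
      ∫ s in Icc 0 T, posPow (β - 1) (s - t) • φ s = 0) :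
    φ =ᵐ[volume.restrict (Icc 0 T)] 0 := by
  refine ae_eq_zero_of_integral_tail hφ fun a ha => ?_
  set C := Real.Gamma (1 - β) * Real.Gamma β
  have hC : 0 < C :=
    mul_pos (Real.Gamma_pos_of_pos (by linarith)) (Real.Gamma_pos_of_pos h0)
  -- Multiply the vanishing fractional integral by `(t - a)₊^(-β)` and integrate in `t`. After
  -- exchanging the integrals, the beta integral collapses the two kernels to `C` times the
  -- indicator of `s > a`, leaving a tail integral of `φ`.
  let F : ℝ → ℝ → X := fun t s => (posPow (-β) (t - a) * posPow (β - 1) (s - t)) • φ s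
  have hF : Integrable (Function.uncurry F)
      ((volume.restrict (Icc 0 T)).prod (volume.restrict (Icc 0 T))) := by
    have hm : AEStronglyMeasurable (Function.uncurry F)
        ((volume.restrict (Icc 0 T)).prod (volume.restrict (Icc 0 T))) := by
      refine AEStronglyMeasurable.smul (Measurable.aestronglyMeasurable ?_)
        hφ.aestronglyMeasurable.comp_snd
      fun_prop
    rw [integrable_prod_iff' hm]
    constructor
    · filter_upwards [ae_restrict_mem measurableSet_Icc] with s hs
      exact (integrableOn_posPow_mul h0 h1 ha.1 hs.2).1.smul_const (φ s)
    · have : Integrable (fun s => C * ‖(Ioi a).indicator φ s‖) (volume.restrict (Icc 0 T)) :=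
        ((hφ.indicator measurableSet_Ioi).norm).const_mul _
      refine this.congr ?_
      filter_upwards [ae_restrict_mem measurableSet_Icc] with s hs
      have hn : ∀ t, ‖Function.uncurry F (t, s)‖ =
          posPow (-β) (t - a) * posPow (β - 1) (s - t) * ‖φ s‖ := fun t => by
        rw [Function.uncurry_apply_pair, norm_smul, Real.norm_of_nonneg
          (mul_nonneg (posPow_nonneg _ _) (posPow_nonneg _ _))]
      simp_rw [hn]
      rw [integral_mul_const, (integrableOn_posPow_mul h0 h1 ha.1 hs.2).2]
      split_ifs with has
      · rw [indicator_of_mem (show s ∈ Ioi a from has)]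
      · rw [indicator_of_notMem (show s ∉ Ioi a from has)]; simp
  have hsw := integral_integral_swap hF
  have hl : ∫ t in Icc 0 T, ∫ s in Icc 0 T, F t s = 0 := by
    refine integral_eq_zero_of_ae ?_
    filter_upwards [h] with t ht
    simp only [F, mul_smul]
    rw [integral_smul, ht, smul_zero, Pi.zero_apply]
  have hr : ∫ s in Icc 0 T, ∫ t in Icc 0 T, F t s = C • ∫ s in Icc 0 T, (Ioi a).indicator φ s := by
    rw [← integral_smul]
    refine setIntegral_congr_fun measurableSet_Icc fun s hs => ?_
    simp only [F]
    rw [integral_smul_const, (integrableOn_posPow_mul h0 h1 ha.1 hs.2).2]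
    split_ifs with has
    · rw [indicator_of_mem (show s ∈ Ioi a from has)]
    · rw [indicator_of_notMem (show s ∉ Ioi a from has)]; simp
  rw [hl, hr] at hsw
  exact (smul_eq_zero.1 hsw.symm).resolve_left hC.ne'

/-- The left-sided version of `ae_eq_zero_of_integral_posPow`. -/
lemma ae_eq_zero_of_integral_posPow_left [CompleteSpace X] {β : ℝ} (h0 : 0 < β) (h1 : β < 1)
    {T : ℝ} {φ : ℝ → X} (hφ : IntegrableOn φ (Icc 0 T))
    (h : ∀ᵐ s ∂(volume.restrict (Icc 0 T)),
      ∫ t in Icc 0 T, posPow (β - 1) (s - t) • φ t = 0) :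
    φ =ᵐ[volume.restrict (Icc 0 T)] 0 := by
  -- The reflection `x ↦ T - x` of `[0, T]` interchanges left-sided and right-sided fractional
  -- integrals.
  have hmp : MeasurePreserving (fun x : ℝ => T - x) (volume.restrict (Icc 0 T))
      (volume.restrict (Icc 0 T)) := by
    have := (volume.measurePreserving_sub_left T).restrict_preimage
      (measurableSet_Icc (a := 0) (b := T))
    rwa [show (fun x : ℝ => T - x) ⁻¹' Icc 0 T = Icc 0 T by
      ext x; simp [and_comm]] at this
  have hemb : MeasurableEmbedding (fun x : ℝ => T - x) :=
    (Homeomorph.subLeft T).measurableEmbedding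
  have key : φ ∘ (fun x => T - x) =ᵐ[volume.restrict (Icc 0 T)] 0 := by
    refine ae_eq_zero_of_integral_posPow h0 h1 ((hmp.integrable_comp_emb hemb).2 hφ) ?_
    filter_upwards [hmp.quasiMeasurePreserving.ae h] with t ht
    rw [← ht, ← hmp.integral_comp hemb]
    refine integral_congr_ae (.of_forall fun s => ?_)
    simp only [Function.comp]
    rw [show T - s - t = T - t - s by ring, sub_sub_cancel]
  have := hmp.quasiMeasurePreserving.ae_eq_comp key
  filter_upwards [this] with x hx
  simpa using hx

lemma IsFracIntegral.unique [CompleteSpace X] {α : ℝ} (h0 : 0 < α) (h1 : α < 1) {T : ℝ}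
    {φ ψ g : L2Interval T X} (hφ : IsFracIntegral α φ g) (hψ : IsFracIntegral α ψ g) : φ = ψ := by
  rw [← sub_eq_zero]
  have hi : Integrable (φ - ψ : L2Interval T X) (volume.restrict (Icc 0 T)) :=
    (Lp.memLp (φ - ψ)).integrable (by norm_num)
  have hz := ae_eq_zero_of_integral_posPow h0 h1 hi ?_
  · exact (Lp.eq_zero_iff_ae_eq_zero).2 hz
  · filter_upwards [hφ, hψ, ae_integrable_posPow_smul (e := α - 1) (by linarith) (by linarith) T φ,
      ae_integrable_posPow_smul (e := α - 1) (by linarith) (by linarith) T ψ,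
      ae_restrict_mem measurableSet_Icc] with t h₁ h₂ h₃ h₄ ht
    rw [h₁, fracIntegral_eq h1 ht.1, fracIntegral_eq h1 ht.1] at h₂
    have h₅ := smul_right_injective X (inv_pos.2 (Real.Gamma_pos_of_pos h0)).ne' h₂
    rw [← sub_eq_zero, ← integral_sub h₃ h₄] at h₅
    rw [← h₅]
    refine integral_congr_ae ?_
    filter_upwards [Lp.coeFn_sub φ ψ] with s hs
    rw [hs, Pi.sub_apply, smul_sub]

end


/-! ### The Mandelbrot–Van Ness representation -/

/-- The moving-average kernel `(s - u)₊ ^ (-a) - (-u)₊ ^ (-a)` of fractional Brownian motion with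
Hurst parameter `1/2 - a`. -/
def mvnKernel (a s u : ℝ) : ℝ := posPow (-a) (s - u) - posPow (-a) (-u)

@[fun_prop]
lemma measurable_mvnKernel (a s : ℝ) : Measurable (mvnKernel a s) := by
  unfold mvnKernel; fun_prop

lemma posPow_sq {a : ℝ} (h0 : 0 < a) (x : ℝ) : posPow (-a) x ^ 2 = posPow (-(2 * a)) x := by
  rcases le_or_gt x 0 with hx | hx
  · rw [posPow_of_nonpos (by linarith) hx, posPow_of_nonpos (by linarith) hx]; simp
  · rw [posPow_of_pos _ hx, posPow_of_pos _ hx, ← Real.rpow_natCast, ← Real.rpow_mul hx.le]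
    congr 1; push_cast; ring

/-- With `u = -r` and `q = r/(1 + r)`, the kernel is `-r^(-a) (1 - q^a)`. As `a ≤ 1` and `q ≤ 1`,
one has `1 - q^a ≤ 1 - q ≤ 1/r`: the two powers cancel to leading order at `-∞`. -/
lemma sq_mvnKernel_one_le {a : ℝ} (h0 : 0 < a) (h1 : a ≤ 1) {u : ℝ} (hu : u < 0) :
    mvnKernel a 1 u ^ 2 ≤ (-u) ^ (-(2 * a) - 2) := by
  obtain ⟨r, rfl⟩ : ∃ r, u = -r := ⟨-u, by ring⟩
  have hr : 0 < r := by linarith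
  unfold mvnKernel
  rw [neg_neg, posPow_of_pos _ hr, posPow_of_pos _ (by linarith), sub_neg_eq_add]
  have hq0 : 0 < r / (1 + r) := by positivity
  have hq1 : r / (1 + r) ≤ 1 := by rw [div_le_one (by linarith)]; linarith
  have e1 : (1 + r) ^ (-a) = r ^ (-a) * (r / (1 + r)) ^ a := by
    rw [Real.div_rpow hr.le (by linarith), Real.rpow_neg hr.le, Real.rpow_neg (by linarith)]
    have := (Real.rpow_pos_of_pos hr a).ne'
    field_simp
  have e2 : r / (1 + r) ≤ (r / (1 + r)) ^ a := by
    conv_lhs => rw [← Real.rpow_one (r / (1 + r))]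
    exact Real.rpow_le_rpow_of_exponent_ge hq0 hq1 h1
  have e3 : (r / (1 + r)) ^ a ≤ 1 := Real.rpow_le_one hq0.le hq1 h0.le
  have e4 : 1 - r / (1 + r) ≤ r⁻¹ := by
    rw [one_sub_div (by positivity), inv_eq_one_div, div_le_div_iff₀ (by positivity) hr]
    nlinarith
  have e5 : r ^ (-(2 * a) - 2) = (r ^ (-a) * r⁻¹) ^ 2 := by
    rw [← Real.rpow_neg_one, ← Real.rpow_add hr, ← Real.rpow_natCast, ← Real.rpow_mul hr.le]
    congr 1; push_cast; ring
  rw [e5, e1, show (r ^ (-a) * (r / (1 + r)) ^ a - r ^ (-a)) ^ 2 =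
    (r ^ (-a) * (1 - (r / (1 + r)) ^ a)) ^ 2 by ring]
  have := (Real.rpow_pos_of_pos hr (-a)).le
  have h2 : 0 ≤ 1 - (r / (1 + r)) ^ a := by linarith
  gcongr
  linarith

/-- Below `-1` the square decays like `|u|^(-2a-2)`. On `[-1, 1]` it is at most twice the sum of the
squares of the two terms, whose singularities of order `2a < 1` are integrable. Beyond `1` it is
zero. -/
lemma integrable_sq_mvnKernel_one {a : ℝ} (h0 : 0 < a) (h1 : a < 1 / 2) :
    Integrable (fun u => mvnKernel a 1 u ^ 2) := by
  have hm : AEStronglyMeasurable (fun u => mvnKernel a 1 u ^ 2) volume :=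
    Measurable.aestronglyMeasurable (by fun_prop)
  have hfar : IntegrableOn (fun u => mvnKernel a 1 u ^ 2) (Iio (-1)) := by
    have hi : IntegrableOn (fun u : ℝ => (-u) ^ (-(2 * a) - 2)) (Iio (-1)) := by
      have := integrableOn_Ioi_rpow_of_lt (show -(2 * a) - 2 < -1 by linarith) one_pos
      have := this.comp_neg
      simpa using this
    refine hi.mono' hm.restrict ?_
    filter_upwards [ae_restrict_mem measurableSet_Iio] with u hu
    have hu' : u < -1 := hu
    rw [Real.norm_of_nonneg (sq_nonneg _)]
    exact sq_mvnKernel_one_le h0 (by linarith) (by linarith)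
  have hmid : IntegrableOn (fun u => mvnKernel a 1 u ^ 2) (Icc (-1) 1) := by
    have h2 : IntegrableOn (posPow (-(2 * a))) (Icc (-2) 2) :=
      integrableOn_posPow (by linarith) (by linarith) _ _
    have hA : IntegrableOn (fun u => posPow (-(2 * a)) (1 - u)) (Icc (-1) 1) := by
      have h3 := ((integrable_indicator_iff measurableSet_Icc).2 h2).comp_sub_left 1
      refine (h3.integrableOn (s := Icc (-1) 1)).congr_fun (fun u hu => ?_) measurableSet_Icc
      exact indicator_of_mem (s := Icc (-2) 2)
        ⟨by linarith [hu.1, hu.2], by linarith [hu.1, hu.2]⟩ _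
    have hB : IntegrableOn (fun u => posPow (-(2 * a)) (-u)) (Icc (-1) 1) := by
      have h3 := ((integrable_indicator_iff measurableSet_Icc).2 h2).comp_neg
      refine (h3.integrableOn (s := Icc (-1) 1)).congr_fun (fun u hu => ?_) measurableSet_Icc
      exact indicator_of_mem (s := Icc (-2) 2)
        ⟨by linarith [hu.1, hu.2], by linarith [hu.1, hu.2]⟩ _
    refine ((hA.const_mul 2).add (hB.const_mul 2)).mono' hm.restrict (.of_forall fun u => ?_)
    rw [Real.norm_of_nonneg (sq_nonneg _)]
    simp only [Pi.add_apply, ← posPow_sq h0]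
    unfold mvnKernel
    nlinarith [sq_nonneg (posPow (-a) (1 - u) + posPow (-a) (-u))]
  have hright : IntegrableOn (fun u => mvnKernel a 1 u ^ 2) (Ioi 1) := by
    refine IntegrableOn.congr_fun (f := fun _ => 0) integrableOn_zero (fun u hu => ?_)
      measurableSet_Ioi
    have hu' : 1 < u := hu
    unfold mvnKernel
    rw [posPow_of_nonpos (by linarith) (by linarith), posPow_of_nonpos (by linarith) (by linarith)]
    simp
  rw [← integrableOn_univ]
  refine ((hfar.union hmid).union hright).mono_set fun u _ => ?_
  rcases lt_or_ge u (-1) with h | h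
  · exact .inl (.inl h)
  · exact (le_or_gt u 1).imp (fun h' => .inr ⟨h, h'⟩) id

/-- The variance `∫ ((1 - u)₊ ^ (-a) - (-u)₊ ^ (-a))² du`. -/
def mvnConst (a : ℝ) : ℝ := ∫ u, mvnKernel a 1 u ^ 2

lemma mvnConst_pos {a : ℝ} (h0 : 0 < a) (h1 : a < 1 / 2) : 0 < mvnConst a := by
  unfold mvnConst
  rw [integral_pos_iff_support_of_nonneg (fun u => sq_nonneg _) (integrable_sq_mvnKernel_one h0 h1)]
  refine lt_of_lt_of_le ?_ (measure_mono (s := Ioo (0 : ℝ) 1) ?_)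
  · simp
  · intro u hu
    have : mvnKernel a 1 u = (1 - u) ^ (-a) := by
      unfold mvnKernel
      rw [posPow_of_pos _ (by linarith [hu.2]), posPow_of_nonpos (by linarith) (by linarith [hu.1]),
        sub_zero]
    simp only [Function.mem_support, this]
    exact pow_ne_zero _ (Real.rpow_pos_of_pos (by linarith [hu.2]) _).ne'

/-- Self-similarity: the kernel at `d` is `d^(-a)` times the kernel at `1` evaluated at `u/d`, and
the change of variables contributes one more factor `d`. -/
lemma integral_sq_mvnKernel {a : ℝ} (h0 : 0 < a) (h1 : a < 1 / 2) {d : ℝ} (hd : 0 < d) :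
    Integrable (fun u => mvnKernel a d u ^ 2) ∧
      ∫ u, mvnKernel a d u ^ 2 = d ^ (1 - 2 * a) * mvnConst a := by
  have hdi : 0 < d⁻¹ := inv_pos.2 hd
  have hfun : (fun u => mvnKernel a d u ^ 2) = fun u =>
      d ^ (-(2 * a)) * mvnKernel a 1 (d⁻¹ * u) ^ 2 := by
    funext u
    have e : mvnKernel a d u = d ^ (-a) * mvnKernel a 1 (d⁻¹ * u) := by
      unfold mvnKernel
      rw [mul_sub, ← posPow_mul _ hd, ← posPow_mul _ hd]
      congr 2 <;> field_simp
    rw [e, mul_pow, ← Real.rpow_natCast (d ^ (-a)), ← Real.rpow_mul hd.le]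
    congr 2; push_cast; ring
  rw [hfun]
  refine ⟨((integrable_sq_mvnKernel_one h0 h1).comp_mul_left' hdi.ne').const_mul _, ?_⟩
  rw [integral_const_mul, Measure.integral_comp_mul_left (fun u => mvnKernel a 1 u ^ 2),
    inv_inv, abs_of_pos hd, smul_eq_mul, ← mul_assoc]
  congr 1
  nth_rw 2 [← Real.rpow_one d]
  rw [← Real.rpow_add hd]; congr 1; ring

/-- Stationary increments: translation by the smaller of the two points reduces to the kernel at `|s
- t|`. -/
lemma integral_sq_posPow_sub {a : ℝ} (h0 : 0 < a) (h1 : a < 1 / 2) (s t : ℝ) :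
    Integrable (fun u => (posPow (-a) (s - u) - posPow (-a) (t - u)) ^ 2) ∧
      ∫ u, (posPow (-a) (s - u) - posPow (-a) (t - u)) ^ 2 =
        |s - t| ^ (1 - 2 * a) * mvnConst a := by
  wlog hst : t ≤ s generalizing s t
  · have := this t s (by linarith)
    rw [abs_sub_comm]
    simpa only [sub_sq_comm (posPow (-a) (s - _))] using this
  rcases hst.eq_or_lt with rfl | hst
  · simp [Real.zero_rpow (show 1 - 2 * a ≠ 0 by linarith)]
  · have hfun : (fun u => (posPow (-a) (s - u) - posPow (-a) (t - u)) ^ 2) = fun u =>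
        mvnKernel a (s - t) (u - t) ^ 2 := by
      funext u
      unfold mvnKernel
      rw [show s - t - (u - t) = s - u by ring, neg_sub]
    obtain ⟨hi, he⟩ := integral_sq_mvnKernel h0 h1 (sub_pos.2 hst)
    rw [hfun, abs_of_pos (sub_pos.2 hst)]
    exact ⟨hi.comp_sub_right t,
      (integral_sub_right_eq_self (fun u => mvnKernel a (s - t) u ^ 2) t).trans he⟩

/-- The covariance of fractional Brownian motion from its moving-average kernel. -/
lemma integral_mvnKernel_mul {a H : ℝ} (h0 : 0 < a) (h1 : a < 1 / 2) (hH : 2 * H = 1 - 2 * a)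
    {s t : ℝ} (hs : 0 ≤ s) (ht : 0 ≤ t) :
    Integrable (fun u => mvnKernel a s u * mvnKernel a t u) ∧
      ∫ u, mvnKernel a s u * mvnKernel a t u = mvnConst a * fbmCov H s t := by
  -- Polarization `2xy = x² + y² - (x - y)²`; in the difference `x - y` the common term `(-u)₊^(-a)`
  -- drops out.
  have hfun : (fun u => mvnKernel a s u * mvnKernel a t u) = fun u =>
      (1 / 2 : ℝ) * ((posPow (-a) (s - u) - posPow (-a) (0 - u)) ^ 2 +
        (posPow (-a) (t - u) - posPow (-a) (0 - u)) ^ 2 -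
        (posPow (-a) (s - u) - posPow (-a) (t - u)) ^ 2) := by
    funext u
    unfold mvnKernel
    rw [zero_sub]; ring
  obtain ⟨i1, e1⟩ := integral_sq_posPow_sub h0 h1 s 0
  obtain ⟨i2, e2⟩ := integral_sq_posPow_sub h0 h1 t 0
  obtain ⟨i3, e3⟩ := integral_sq_posPow_sub h0 h1 s t
  rw [hfun]
  refine ⟨((i1.add i2).sub i3).const_mul _, ?_⟩
  rw [integral_const_mul]
  erw [integral_sub (i1.add i2) i3]
  erw [integral_add i1 i2]
  rw [e1, e2, e3, sub_zero, sub_zero, abs_of_nonneg hs, abs_of_nonneg ht]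
  unfold fbmCov
  rw [hH]; ring

section

variable {T : ℝ} {X : Type*} [NormedAddCommGroup X] [InnerProductSpace ℝ X]

/-- The moving-average integrand on `ℝ` of the step function with coefficients `c`. -/
def mvnSum (a : ℝ) (c : Ioc (0 : ℝ) T →₀ X) (u : ℝ) : X :=
  c.sum fun s x => mvnKernel a s u • x

/-- Expanding the square gives a double sum over nodes, and integrating each term produces the
covariance. Up to the factor `mvnConst a`, this embeds `ℰ` isometrically in `L²(ℝ; X)`. -/
lemma lintegral_mvnSum_sq {H : Ioo (0 : ℝ) 1} {a : ℝ} (h0 : 0 < a) (h1 : a < 1 / 2)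
    (hH : 2 * (H : ℝ) = 1 - 2 * a) (f : SimpleFn T X H) :
    ∫⁻ u, ‖mvnSum a (SimpleFn.coeff f) u‖ₑ ^ 2 = ENNReal.ofReal (mvnConst a * ‖f‖ ^ 2) := by
  set c := SimpleFn.coeff f with hc
  have hsq : (fun u => ‖mvnSum a c u‖ ^ 2) = fun u => ∑ s ∈ c.support, ∑ t ∈ c.support,
      inner ℝ (c s) (c t) * (mvnKernel a s u * mvnKernel a t u) := by
    funext u
    rw [← real_inner_self_eq_norm_sq]
    unfold mvnSum Finsupp.sum
    simp only [sum_inner, inner_sum, real_inner_smul_left, real_inner_smul_right]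
    refine Finset.sum_congr rfl fun i _ => Finset.sum_congr rfl fun j _ => ?_
    rw [real_inner_comm (c i) (c j)]; ring
  have hij : ∀ s t : Ioc (0 : ℝ) T, Integrable (fun u => inner ℝ (c s) (c t) *
      (mvnKernel a s u * mvnKernel a t u)) := fun s t =>
    ((integral_mvnKernel_mul h0 h1 hH s.2.1.le t.2.1.le).1).const_mul _
  have hi : Integrable fun u => ‖mvnSum a c u‖ ^ 2 := by
    rw [hsq]
    exact integrable_finsetSum _ fun s _ => integrable_finsetSum _ fun t _ => hij s t
  have he : ∫ u, ‖mvnSum a c u‖ ^ 2 = mvnConst a * ‖f‖ ^ 2 := by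
    rw [← real_inner_self_eq_norm_sq, SimpleFn.inner_def, hsq,
      integral_finsetSum _ fun s _ => integrable_finsetSum _ fun t _ => hij s t]
    unfold Finsupp.sum
    rw [Finset.mul_sum]
    refine Finset.sum_congr rfl fun s _ => ?_
    rw [integral_finsetSum _ fun t _ => hij s t, Finset.mul_sum]
    refine Finset.sum_congr rfl fun t _ => ?_
    rw [integral_const_mul, (integral_mvnKernel_mul h0 h1 hH s.2.1.le t.2.1.le).2, ← hc]
    ring
  rw [← he, ofReal_integral_eq_lintegral_ofReal hi (.of_forall fun u => sq_nonneg _)]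
  congr 1; funext u
  rw [ENNReal.ofReal_pow (norm_nonneg _), ofReal_norm]

end


/-! ### A Hardy-type inequality -/

lemma lintegral_Ioc_rpow {e : ℝ} (he : -1 < e) {x : ℝ} (hx : 0 ≤ x) :
    ∫⁻ y in Ioc 0 x, ENNReal.ofReal (y ^ e) = ENNReal.ofReal (x ^ (e + 1) / (e + 1)) := by
  have hi := intervalIntegral.intervalIntegrable_rpow' (a := 0) (b := x) he
  rw [intervalIntegrable_iff_integrableOn_Ioc_of_le hx] at hi
  rw [← ofReal_integral_eq_lintegral_ofReal hi, ← intervalIntegral.integral_of_le hx,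
    integral_rpow (.inl he), Real.zero_rpow (by linarith), sub_zero]
  filter_upwards [ae_restrict_mem measurableSet_Ioc] with y hy
  exact Real.rpow_nonneg hy.1.le _

lemma lintegral_Ioi_rpow {e : ℝ} (he : e < -1) {x : ℝ} (hx : 0 < x) :
    ∫⁻ y in Ioi x, ENNReal.ofReal (y ^ e) = ENNReal.ofReal (x ^ (e + 1) / (-(e + 1))) := by
  rw [← ofReal_integral_eq_lintegral_ofReal (integrableOn_Ioi_rpow_of_lt he hx),
    integral_Ioi_rpow_of_lt he hx, neg_div, div_neg]
  filter_upwards [ae_restrict_mem measurableSet_Ioi] with y hy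
  exact Real.rpow_nonneg (hx.trans hy).le _

/-- The kernel is homogeneous of degree `-1`, so the weight `y^(-1/2)` is reproduced up to a
constant. The denominator is bounded below by `x` for `y ≤ x` and by `y` for `y > x`; convergence at
`0` and at `∞` is exactly `|b| < 1/2`. -/
lemma lintegral_homogeneous_kernel_le {b : ℝ} (h0 : -(1 / 2) < b) (h1 : b < 1 / 2) {x : ℝ}
    (hx : 0 < x) :
    ∫⁻ y in Ioi 0, ENNReal.ofReal ((y / x) ^ b / (y + x)) *
        ENNReal.ofReal (y ^ (-(1 / 2) : ℝ)) ≤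
      ENNReal.ofReal (1 / (1 / 2 + b) + 1 / (1 / 2 - b)) *
        ENNReal.ofReal (x ^ (-(1 / 2) : ℝ)) := by
  have hxp : ∀ e : ℝ, 0 ≤ x ^ e := fun e => Real.rpow_nonneg hx.le e
  have hprod : ∀ y, 0 < y → ENNReal.ofReal ((y / x) ^ b / (y + x)) *
      ENNReal.ofReal (y ^ (-(1 / 2) : ℝ)) =
      ENNReal.ofReal (x ^ (-b)) * ENNReal.ofReal (y ^ (b - 1 / 2) / (y + x)) := fun y hy => by
    rw [← ENNReal.ofReal_mul (by positivity), ← ENNReal.ofReal_mul (hxp _)]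
    congr 1
    rw [Real.div_rpow hy.le hx.le, Real.rpow_neg hx.le, sub_eq_add_neg, Real.rpow_add hy]
    field_simp
  have hsmall : ∫⁻ y in Ioc 0 x, ENNReal.ofReal (y ^ (b - 1 / 2) / (y + x)) ≤
      ENNReal.ofReal (x⁻¹ * (x ^ (b + 1 / 2) / (b + 1 / 2))) := by
    rw [ENNReal.ofReal_mul (by positivity), show b + 1 / 2 = b - 1 / 2 + 1 by ring,
      ← lintegral_Ioc_rpow (by linarith) hx.le, ← lintegral_const_mul' _ _ ENNReal.ofReal_ne_top]
    refine setLIntegral_mono' measurableSet_Ioc fun y hy => ?_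
    rw [← ENNReal.ofReal_mul (by positivity)]
    refine ENNReal.ofReal_le_ofReal ?_
    rw [div_eq_inv_mul]
    have := Real.rpow_nonneg hy.1.le (b - 1 / 2)
    have hy0 := hy.1
    gcongr
    linarith
  have hlarge : ∫⁻ y in Ioi x, ENNReal.ofReal (y ^ (b - 1 / 2) / (y + x)) ≤
      ENNReal.ofReal (x ^ (b - 1 / 2) / (1 / 2 - b)) := by
    rw [show b - 1 / 2 = b - 3 / 2 + 1 by ring, show 1 / 2 - b = -(b - 3 / 2 + 1) by ring,
      ← lintegral_Ioi_rpow (by linarith) hx]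
    refine setLIntegral_mono' measurableSet_Ioi fun y hy => ENNReal.ofReal_le_ofReal ?_
    have hy0 : 0 < y := hx.trans hy
    rw [Real.rpow_add hy0, Real.rpow_one, div_le_iff₀ (by linarith)]
    have := Real.rpow_nonneg hy0.le (b - 3 / 2)
    gcongr
    linarith
  calc _ = ∫⁻ y in Ioi 0, ENNReal.ofReal (x ^ (-b)) *
          ENNReal.ofReal (y ^ (b - 1 / 2) / (y + x)) :=
        setLIntegral_congr_fun measurableSet_Ioi fun y hy => hprod y hy
    _ = ENNReal.ofReal (x ^ (-b)) * ((∫⁻ y in Ioc 0 x, ENNReal.ofReal (y ^ (b - 1 / 2) / (y + x))) +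
          ∫⁻ y in Ioi x, ENNReal.ofReal (y ^ (b - 1 / 2) / (y + x))) := by
        rw [lintegral_const_mul' _ _ ENNReal.ofReal_ne_top, ← Ioc_union_Ioi_eq_Ioi hx.le,
          lintegral_union measurableSet_Ioi (Ioc_disjoint_Ioi le_rfl)]
    _ ≤ ENNReal.ofReal (x ^ (-b)) * (ENNReal.ofReal (x⁻¹ * (x ^ (b + 1 / 2) / (b + 1 / 2))) +
          ENNReal.ofReal (x ^ (b - 1 / 2) / (1 / 2 - b))) := by gcongr
    _ = _ := by
        have p1 : 0 < b + 1 / 2 := by linarith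
        have p2 : 0 < 1 / 2 - b := by linarith
        have p3 : 0 < 1 / 2 + b := by linarith
        rw [← ENNReal.ofReal_add (by positivity) (by positivity),
          ← ENNReal.ofReal_mul (by positivity), ← ENNReal.ofReal_mul (by positivity)]
        congr 1
        have e1 : x ^ (-b) * (x⁻¹ * x ^ (b + 1 / 2)) = x ^ (-(1 / 2) : ℝ) := by
          rw [← Real.rpow_neg_one, ← Real.rpow_add hx, ← Real.rpow_add hx]; congr 1; ring
        have e2 : x ^ (-b) * x ^ (b - 1 / 2) = x ^ (-(1 / 2) : ℝ) := by
          rw [← Real.rpow_add hx]; congr 1; ring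
        rw [← e2] at e1
        rw [← e2, add_comm (1 / 2) b, mul_add, mul_div_assoc', mul_div_assoc', mul_div_assoc', e1]
        ring

/-- Schur test with weights `v^(-1/2)` and `r^(-1/2)`. Exchanging the roles of the variables
replaces the exponent `a` by `-a`, which leaves the constant unchanged. -/
lemma lintegral_sq_hardy_le {a : ℝ} (h0 : 0 < a) (h1 : a < 1 / 2) (T : ℝ) {f : ℝ → ℝ≥0∞}
    (hf : Measurable f) :
    ∫⁻ r in Ioi 0, (∫⁻ v in Ioc 0 T, ENNReal.ofReal ((v / r) ^ a / (v + r)) * f v) ^ 2 ≤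
      ENNReal.ofReal (1 / (1 / 2 + a) + 1 / (1 / 2 - a)) *
        ENNReal.ofReal (1 / (1 / 2 + a) + 1 / (1 / 2 - a)) * ∫⁻ v in Ioc 0 T, f v ^ 2 := by
  refine lintegral_sq_kernel_le (volume.restrict (Ioi 0)) (volume.restrict (Ioc 0 T))
    (k := fun r v => ENNReal.ofReal ((v / r) ^ a / (v + r)))
    (w := fun v => ENNReal.ofReal (v ^ (-(1 / 2) : ℝ)))
    (w' := fun r => ENNReal.ofReal (r ^ (-(1 / 2) : ℝ))) ?_ (by fun_prop) (by fun_prop) ?_ ?_ ?_ hf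
  · have : Measurable fun p : ℝ × ℝ => (p.2 / p.1) ^ a / (p.2 + p.1) := by fun_prop
    exact this.ennreal_ofReal
  · filter_upwards [ae_restrict_mem measurableSet_Ioc] with v hv
    refine ⟨?_, ENNReal.ofReal_ne_top⟩
    simpa using Real.rpow_pos_of_pos hv.1 _
  · filter_upwards [ae_restrict_mem measurableSet_Ioi] with r hr
    exact (lintegral_mono_set Ioc_subset_Ioi_self).trans
      (lintegral_homogeneous_kernel_le (by linarith) h1 hr)
  · filter_upwards [ae_restrict_mem measurableSet_Ioc] with v hv
    have h := lintegral_homogeneous_kernel_le (b := -a) (by linarith) (by linarith) hv.1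
    rw [show 1 / 2 - -a = 1 / 2 + a by ring, show 1 / 2 + -a = 1 / 2 - a by ring, add_comm] at h
    refine le_trans (le_of_eq ?_) h
    refine setLIntegral_congr_fun measurableSet_Ioi fun r hr => ?_
    rw [add_comm v r, ← inv_div r v, Real.inv_rpow (div_pos hr hv.1).le,
      Real.rpow_neg (div_pos hr hv.1).le]

lemma lintegral_rpow_mul_posPow_le {a : ℝ} (h0 : 0 < a) (h1 : a < 1) (T : ℝ) {r v : ℝ}
    (hr : 0 < r) (hv : 0 < v) :
    ∫⁻ y in Icc 0 T, ENNReal.ofReal ((y + r) ^ (-a - 1)) * ENNReal.ofReal (posPow (a - 1) (v - y)) ≤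
      ENNReal.ofReal ((v / r) ^ a / (a * (v + r))) := by
  let g : ℝ → ℝ := fun y => (y + r) ^ (-a - 1) * (v - y) ^ (a - 1)
  -- An explicit antiderivative of `g`, continuous up to `y = v` although `g` is singular there.
  -- Positivity of `g` then supplies its integrability.
  let G : ℝ → ℝ := fun y => -(((v - y) / (y + r)) ^ a / (a * (v + r)))
  have hvr : 0 < a * (v + r) := by positivity
  have hcont : ContinuousOn G (Icc 0 v) := by
    refine ContinuousOn.neg (ContinuousOn.div_const (ContinuousOn.rpow_const ?_ ?_) _)
    · exact ContinuousOn.div (by fun_prop) (by fun_prop) fun y hy => by linarith [hy.1]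
    · exact fun _ _ => .inr h0.le
  have hderiv : ∀ y ∈ Ioo 0 v, HasDerivAt G (g y) y := by
    intro y hy
    have hyr : 0 < y + r := by linarith [hy.1]
    have hvy : 0 < v - y := by linarith [hy.2]
    have d1 : HasDerivAt (fun y => (v - y) / (y + r))
        ((-1 * (y + r) - (v - y) * 1) / (y + r) ^ 2) y :=
      ((hasDerivAt_id y).const_sub v).div ((hasDerivAt_id y).add_const r) hyr.ne'
    have d2 := ((d1.rpow_const (p := a) (.inl (div_pos hvy hyr).ne')).div_const
      (a * (v + r))).neg
    convert! d2 using 1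
    simp only [g]
    rw [Real.div_rpow hvy.le hyr.le, show -a - 1 = -(a - 1) - 2 by ring, Real.rpow_sub hyr,
      Real.rpow_neg hyr.le, Real.rpow_two]
    have := (Real.rpow_pos_of_pos hyr (a - 1)).ne'
    field_simp
    ring
  have hpos : ∀ y ∈ Ioo 0 v, 0 ≤ g y := fun y hy =>
    mul_nonneg (Real.rpow_nonneg (by linarith [hy.1]) _) (Real.rpow_nonneg (by linarith [hy.2]) _)
  have hint := intervalIntegral.integrableOn_deriv_of_nonneg hcont hderiv hpos
  have hval : ∫ y in Ioc 0 v, g y = (v / r) ^ a / (a * (v + r)) := by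
    rw [← intervalIntegral.integral_of_le hv.le,
      intervalIntegral.integral_eq_sub_of_hasDerivAt_of_le hv.le hcont hderiv
        ((intervalIntegrable_iff_integrableOn_Ioc_of_le hv.le).2 hint)]
    simp [G, Real.zero_rpow h0.ne']
  rw [← hval, integral_Ioc_eq_integral_Ioo, ofReal_integral_eq_lintegral_ofReal
    (hint.mono_set Ioo_subset_Ioc_self) (by
      filter_upwards [ae_restrict_mem measurableSet_Ioo] with y hy using hpos y hy),
    ← lintegral_indicator measurableSet_Ioo, ← Measure.restrict_congr_set Ioc_ae_eq_Icc,
    ← lintegral_indicator measurableSet_Ioc]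
  refine lintegral_mono fun y => ?_
  by_cases hy : y ∈ Ioc 0 T
  · rw [indicator_of_mem hy, ← ENNReal.ofReal_mul (Real.rpow_nonneg (by linarith [hy.1]) _)]
    rcases lt_or_ge y v with h | h
    · rw [indicator_of_mem (s := Ioo 0 v) ⟨hy.1, h⟩, posPow_of_pos _ (by linarith)]
    · rw [posPow_of_nonpos (by linarith) (by linarith)]; simp
  · rw [indicator_of_notMem hy]; exact zero_le


/-! ### Fractional derivatives of step functions -/

section

variable {T : ℝ} {X : Type*} [NormedAddCommGroup X] [InnerProductSpace ℝ X]

/-- The fractional derivative of order `a` of the step function with coefficients `c`: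
`∑ s, Γ(1 - a)⁻¹ (s - u)₊ ^ (-a) x_s`. -/
def fracDeriv (a : ℝ) (c : Ioc (0 : ℝ) T →₀ X) (u : ℝ) : X :=
  c.sum fun s x => ((Real.Gamma (1 - a))⁻¹ * posPow (-a) (s - u)) • x

lemma stronglyMeasurable_fracDeriv (a : ℝ) (c : Ioc (0 : ℝ) T →₀ X) :
    StronglyMeasurable (fracDeriv a c) := by
  unfold fracDeriv Finsupp.sum
  refine Finset.stronglyMeasurable_fun_sum _ fun s _ => ?_
  refine StronglyMeasurable.smul_const (Measurable.stronglyMeasurable ?_) _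
  fun_prop

lemma fracDeriv_add (a : ℝ) (c d : Ioc (0 : ℝ) T →₀ X) :
    fracDeriv a (c + d) = fracDeriv a c + fracDeriv a d := by
  funext u
  exact Finsupp.sum_add_index' (fun _ => smul_zero _) (fun _ _ _ => smul_add _ _ _)

lemma fracDeriv_smul (a r : ℝ) (c : Ioc (0 : ℝ) T →₀ X) :
    fracDeriv a (r • c) = r • fracDeriv a c := by
  funext u
  unfold fracDeriv
  rw [Finsupp.sum_smul_index' (fun _ => smul_zero _), Pi.smul_apply, Finsupp.smul_sum]
  simp only [smul_comm r]

lemma fracDeriv_single (a : ℝ) (s : Ioc (0 : ℝ) T) (x : X) (u : ℝ) :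
    fracDeriv a (Finsupp.single s x) u =
      ((Real.Gamma (1 - a))⁻¹ * posPow (-a) (s - u)) • x :=
  Finsupp.sum_single_index (smul_zero _)

/-- The fractional integral of `fracDeriv a c` is the step function with coefficients `c`. -/
lemma fracIntegral_fracDeriv [CompleteSpace X] {a : ℝ} (h0 : 0 < a) (h1 : a < 1) (c : Ioc (0 : ℝ) T →₀ X) {t : ℝ}
    (ht : 0 ≤ t) : fracIntegral a T (fracDeriv a c) t = stepMap T X c t := by
  have hG := (Real.Gamma_pos_of_pos h0).ne'
  have hG' := (Real.Gamma_pos_of_pos (sub_pos.2 h1)).ne'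
  rw [fracIntegral_eq h1 ht, stepMap_apply]
  have key : ∀ s : Ioc (0 : ℝ) T,
      IntegrableOn (fun v => posPow (a - 1) (v - t) * posPow (-a) (s - v)) (Icc 0 T) ∧
      ∫ v in Icc 0 T, posPow (a - 1) (v - t) * posPow (-a) (s - v) =
        if t < s then Real.Gamma a * Real.Gamma (1 - a) else 0 := fun s => by
    have := integrableOn_posPow_mul (β := 1 - a) (by linarith) (by linarith) ht s.2.2
    simpa only [show -(1 - a) = a - 1 by ring, show 1 - a - 1 = -a by ring,
      sub_sub_cancel] using this
  have hsum : (fun v => posPow (a - 1) (v - t) • fracDeriv a c v) = fun v =>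
      ∑ s ∈ c.support, ((posPow (a - 1) (v - t) * posPow (-a) (s - v)) •
        (Real.Gamma (1 - a))⁻¹ • c s) := by
    funext v
    unfold fracDeriv Finsupp.sum
    rw [Finset.smul_sum]
    refine Finset.sum_congr rfl fun s _ => ?_
    simp only [smul_smul]; congr 1; ring
  rw [hsum, integral_finsetSum _ fun s _ => (key s).1.smul_const _, Finset.smul_sum]
  refine Finset.sum_congr rfl fun s _ => ?_
  simp only
  rw [integral_smul_const, (key s).2]
  split_ifs with hts
  · rw [indicator_of_mem (show t ∈ Ico (0 : ℝ) s from ⟨ht, hts⟩), smul_smul, smul_smul,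
      show (Real.Gamma a)⁻¹ * (Real.Gamma a * Real.Gamma (1 - a)) * (Real.Gamma (1 - a))⁻¹ = 1 by
        field_simp, one_smul]
  · rw [indicator_of_notMem (show t ∉ Ico (0 : ℝ) s from fun h => hts h.2)]; simp

/-! ### The moving-average integrand on `[0, T]`, beyond `T`, and on the negative half-line -/

lemma mvnSum_of_mem_Icc {a : ℝ} (h0 : 0 < a) (h1 : a < 1) (c : Ioc (0 : ℝ) T →₀ X) {u : ℝ}
    (hu : 0 ≤ u) : mvnSum a c u = Real.Gamma (1 - a) • fracDeriv a c u := by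
  unfold mvnSum fracDeriv
  rw [Finsupp.smul_sum]
  refine Finsupp.sum_congr fun s _ => ?_
  unfold mvnKernel
  rw [posPow_of_nonpos (x := -u) (by linarith) (by linarith), sub_zero, smul_smul,
    mul_inv_cancel_left₀ (Real.Gamma_pos_of_pos (sub_pos.2 h1)).ne']

lemma mvnSum_of_gt {a : ℝ} (h0 : 0 < a) (hT : 0 ≤ T) (c : Ioc (0 : ℝ) T →₀ X) {u : ℝ}
    (hu : T < u) : mvnSum a c u = 0 := by
  unfold mvnSum
  refine Finset.sum_eq_zero fun s _ => ?_
  unfold mvnKernel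
  have := s.2.2
  simp only
  rw [posPow_of_nonpos (x := -u) (by linarith) (by linarith),
    posPow_of_nonpos (x := s - u) (by linarith) (by linarith), sub_zero, zero_smul]

/-- For a single node, `(s + r)^(-a) - r^(-a)` is `-a` times the integral of `(y + r)^(-a-1)` over
`[0, s)`. The past is thereby expressed through the values of the step function instead of its
coefficients. -/
lemma mvnSum_neg [CompleteSpace X] {a : ℝ} (h0 : 0 < a) (c : Ioc (0 : ℝ) T →₀ X) {r : ℝ} (hr : 0 < r) :
    mvnSum a c (-r) = -a • ∫ y in Icc 0 T, (y + r) ^ (-a - 1) • stepMap T X c y := by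
  have hcont : ContinuousOn (fun y : ℝ => (y + r) ^ (-a - 1)) (Ici 0) :=
    ContinuousOn.rpow_const (by fun_prop) fun y hy => .inl (by
      have : (0 : ℝ) ≤ y := hy
      positivity)
  have hind : ∀ (s : Ioc (0 : ℝ) T) (x : X), (fun y => (y + r) ^ (-a - 1) •
      (Ico (0 : ℝ) s).indicator (fun _ => x) y) =
      (Ico (0 : ℝ) s).indicator fun y => (y + r) ^ (-a - 1) • x := fun s x => by
    funext y
    by_cases hy : y ∈ Ico (0 : ℝ) s <;> simp [hy]
  have hi : ∀ (s : Ioc (0 : ℝ) T) (x : X), IntegrableOn (fun y => (y + r) ^ (-a - 1) •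
      (Ico (0 : ℝ) s).indicator (fun _ => x) y) (Icc 0 T) := fun s x => by
    rw [hind]
    refine Integrable.indicator ?_ measurableSet_Ico
    exact (((hcont.mono Icc_subset_Ici_self).integrableOn_Icc).smul_const x)
  have he : ∀ (s : Ioc (0 : ℝ) T) (x : X), -a • ∫ y in Icc 0 T, (y + r) ^ (-a - 1) •
      (Ico (0 : ℝ) s).indicator (fun _ => x) y = mvnKernel a s (-r) • x := fun s x => by
    have hs : (0 : ℝ) < s := s.2.1
    have hset : Icc 0 T ∩ Ico (0 : ℝ) s = Ico 0 (s : ℝ) :=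
      inter_eq_right.2 fun y hy => ⟨hy.1, hy.2.le.trans s.2.2⟩
    rw [hind, setIntegral_indicator measurableSet_Ico, hset, integral_smul_const,
      integral_Ico_eq_integral_Ioo, ← integral_Ioc_eq_integral_Ioo,
      ← intervalIntegral.integral_of_le hs.le,
      intervalIntegral.integral_comp_add_right (fun y => y ^ (-a - 1)),
      integral_rpow (.inr ⟨by linarith, ?_⟩), smul_smul]
    · congr 1
      unfold mvnKernel
      rw [neg_neg, sub_neg_eq_add, posPow_of_pos _ hr, posPow_of_pos _ (by linarith), zero_add,
        show -a - 1 + 1 = -a by ring]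
      field_simp
    · rw [uIcc_of_le (by linarith), zero_add]
      exact fun h => absurd h.1 (not_le.2 hr)
  have hsum : (fun y => (y + r) ^ (-a - 1) • stepMap T X c y) = fun y => ∑ s ∈ c.support,
      (y + r) ^ (-a - 1) • (Ico (0 : ℝ) s).indicator (fun _ => c s) y := by
    funext y
    rw [stepMap_apply, Finsupp.sum, Finset.smul_sum]
  rw [hsum, integral_finsetSum _ fun s _ => hi s (c s), Finset.smul_sum]
  exact Finset.sum_congr rfl fun s _ => (he s (c s)).symm

/-- In `mvnSum_neg`, replace the step function by the fractional integral of its fractional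
derivative and apply Tonelli. The inner integral is the one bounded in
`lintegral_rpow_mul_posPow_le`, whose factor `1/a` cancels the prefactor `a`. -/
lemma enorm_mvnSum_neg_le [CompleteSpace X] {a : ℝ} (h0 : 0 < a) (h1 : a < 1) (c : Ioc (0 : ℝ) T →₀ X) {r : ℝ}
    (hr : 0 < r) :
    ‖mvnSum a c (-r)‖ₑ ≤ ENNReal.ofReal (Real.Gamma a)⁻¹ *
      ∫⁻ v in Ioc 0 T, ENNReal.ofReal ((v / r) ^ a / (v + r)) * ‖fracDeriv a c v‖ₑ := by
  have hG : 0 < (Real.Gamma a)⁻¹ := inv_pos.2 (Real.Gamma_pos_of_pos h0)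
  have hmD : Measurable fun v => ‖fracDeriv a c v‖ₑ := (stronglyMeasurable_fracDeriv a c).enorm
  have hm : Measurable (Function.uncurry fun y v : ℝ => ENNReal.ofReal ((y + r) ^ (-a - 1)) *
      ENNReal.ofReal (posPow (a - 1) (v - y)) * ‖fracDeriv a c v‖ₑ) := by
    refine Measurable.mul (Measurable.mul ?_ ?_) (hmD.comp measurable_snd)
    · fun_prop
    · exact ((measurable_posPow _).comp (measurable_snd.sub measurable_fst)).ennreal_ofReal
  rw [mvnSum_neg h0 c hr, enorm_smul]
  calc _ ≤ ENNReal.ofReal a * ∫⁻ y in Icc 0 T, ENNReal.ofReal ((y + r) ^ (-a - 1)) *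
          (ENNReal.ofReal (Real.Gamma a)⁻¹ * ∫⁻ v in Icc 0 T,
            ENNReal.ofReal (posPow (a - 1) (v - y)) * ‖fracDeriv a c v‖ₑ) := by
        rw [enorm_neg, Real.enorm_of_nonneg h0.le]
        gcongr
        refine (enorm_integral_le_lintegral_enorm _).trans
          (setLIntegral_mono' measurableSet_Icc fun y hy => ?_)
        rw [enorm_smul, Real.enorm_of_nonneg (Real.rpow_nonneg (by linarith [hy.1]) _),
          ← fracIntegral_fracDeriv h0 h1 c hy.1, fracIntegral_eq h1 hy.1, enorm_smul,
          Real.enorm_of_nonneg hG.le]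
        gcongr
        exact enorm_integral_posPow_le _ _ _ _
    _ = ENNReal.ofReal (Real.Gamma a)⁻¹ * (ENNReal.ofReal a * ∫⁻ y in Icc 0 T, ∫⁻ v in Icc 0 T,
          ENNReal.ofReal ((y + r) ^ (-a - 1)) * ENNReal.ofReal (posPow (a - 1) (v - y)) *
            ‖fracDeriv a c v‖ₑ) := by
        rw [mul_left_comm, ← lintegral_const_mul' (ENNReal.ofReal (Real.Gamma a)⁻¹) _
          ENNReal.ofReal_ne_top]
        congr 1
        refine lintegral_congr fun y => ?_
        rw [mul_left_comm, ← lintegral_const_mul' _ _ ENNReal.ofReal_ne_top]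
        simp only [mul_assoc]
    _ = ENNReal.ofReal (Real.Gamma a)⁻¹ * (ENNReal.ofReal a * ∫⁻ v in Ioc 0 T,
          (∫⁻ y in Icc 0 T, ENNReal.ofReal ((y + r) ^ (-a - 1)) *
            ENNReal.ofReal (posPow (a - 1) (v - y))) * ‖fracDeriv a c v‖ₑ) := by
        rw [lintegral_lintegral_swap hm.aemeasurable, ← Measure.restrict_congr_set Ioc_ae_eq_Icc]
        congr 2
        refine lintegral_congr fun v => ?_
        rw [lintegral_mul_const _ (by fun_prop)]
    _ ≤ ENNReal.ofReal (Real.Gamma a)⁻¹ * (ENNReal.ofReal a * ∫⁻ v in Ioc 0 T,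
          ENNReal.ofReal ((v / r) ^ a / (a * (v + r))) * ‖fracDeriv a c v‖ₑ) := by
        gcongr 2
        refine setLIntegral_mono' measurableSet_Ioc fun v hv => ?_
        gcongr
        exact lintegral_rpow_mul_posPow_le h0 h1 T hr hv.1
    _ = _ := by
        rw [← lintegral_const_mul' _ _ ENNReal.ofReal_ne_top]
        congr 1
        refine setLIntegral_congr_fun measurableSet_Ioc fun v hv => ?_
        have := hv.1
        rw [← mul_assoc, ← ENNReal.ofReal_mul h0.le]
        congr 2
        field_simp

lemma lintegral_Iio_eq (f : ℝ → ℝ≥0∞) : ∫⁻ u in Iio 0, f u = ∫⁻ r in Ioi 0, f (-r) := by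
  rw [← lintegral_indicator measurableSet_Iio, ← lintegral_indicator measurableSet_Ioi,
    ← lintegral_neg_eq_self]
  refine lintegral_congr fun r => ?_
  simp [indicator]

/-- The norm of `𝓜` dominates the `L²` norm of the fractional derivative, and conversely. -/
lemma exists_norm_fracDeriv_equiv [CompleteSpace X] {H : Ioo (0 : ℝ) 1} {a : ℝ} (h0 : 0 < a) (h1 : a < 1 / 2)
    (hH : 2 * (H : ℝ) = 1 - 2 * a) (hT : 0 ≤ T) :
    ∃ A B : ℝ, 0 < A ∧ 0 < B ∧ ∀ f : SimpleFn T X H,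
      ∫⁻ u in Icc 0 T, ‖fracDeriv a (SimpleFn.coeff f) u‖ₑ ^ 2 ≤ ENNReal.ofReal (A * ‖f‖ ^ 2) ∧
      ENNReal.ofReal (‖f‖ ^ 2) ≤ ENNReal.ofReal B *
        ∫⁻ u in Icc 0 T, ‖fracDeriv a (SimpleFn.coeff f) u‖ₑ ^ 2 := by
  have ha1 : a < 1 := by linarith
  have hG : 0 < Real.Gamma (1 - a) := Real.Gamma_pos_of_pos (sub_pos.2 ha1)
  have hGa : 0 < Real.Gamma a := Real.Gamma_pos_of_pos h0
  have hc := mvnConst_pos h0 h1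
  set S := 1 / (1 / 2 + a) + 1 / (1 / 2 - a)
  have hS0 : 0 < S := by
    have : 0 < 1 / 2 - a := by linarith
    positivity
  have hmid : ∀ c : Ioc (0 : ℝ) T →₀ X, ∫⁻ u in Icc 0 T, ‖mvnSum a c u‖ₑ ^ 2 =
      ENNReal.ofReal (Real.Gamma (1 - a) ^ 2) * ∫⁻ u in Icc 0 T, ‖fracDeriv a c u‖ₑ ^ 2 :=
    fun c => by
    rw [← lintegral_const_mul' _ _ ENNReal.ofReal_ne_top]
    refine setLIntegral_congr_fun measurableSet_Icc fun u hu => ?_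
    rw [mvnSum_of_mem_Icc h0 ha1 c hu.1, enorm_smul, Real.enorm_of_nonneg hG.le, mul_pow,
      ENNReal.ofReal_pow hG.le]
  have hleft : ∀ c : Ioc (0 : ℝ) T →₀ X, ∫⁻ u in Iio 0, ‖mvnSum a c u‖ₑ ^ 2 ≤
      ENNReal.ofReal (((Real.Gamma a)⁻¹ * S) ^ 2) *
        ∫⁻ u in Icc 0 T, ‖fracDeriv a c u‖ₑ ^ 2 := fun c => by
    rw [lintegral_Iio_eq]
    calc _ ≤ ∫⁻ r in Ioi 0, ENNReal.ofReal (Real.Gamma a)⁻¹ ^ 2 * (∫⁻ v in Ioc 0 T,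
            ENNReal.ofReal ((v / r) ^ a / (v + r)) * ‖fracDeriv a c v‖ₑ) ^ 2 := by
          refine setLIntegral_mono' measurableSet_Ioi fun r hr => ?_
          rw [← mul_pow]
          gcongr
          exact enorm_mvnSum_neg_le h0 ha1 c hr
      _ ≤ ENNReal.ofReal (Real.Gamma a)⁻¹ ^ 2 * (ENNReal.ofReal S * ENNReal.ofReal S *
            ∫⁻ v in Ioc 0 T, ‖fracDeriv a c v‖ₑ ^ 2) := by
          rw [lintegral_const_mul' _ _ (by simp)]
          gcongr
          exact lintegral_sq_hardy_le h0 h1 T (stronglyMeasurable_fracDeriv a c).enorm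
      _ = _ := by
          rw [Measure.restrict_congr_set Ioc_ae_eq_Icc, ENNReal.ofReal_pow (by positivity),
            ENNReal.ofReal_mul (by positivity)]
          ring
  have hsplit : ∀ c : Ioc (0 : ℝ) T →₀ X, ∫⁻ u, ‖mvnSum a c u‖ₑ ^ 2 ≤
      (∫⁻ u in Iio 0, ‖mvnSum a c u‖ₑ ^ 2) + ∫⁻ u in Icc 0 T, ‖mvnSum a c u‖ₑ ^ 2 := fun c => by
    have hsub : (univ : Set ℝ) ⊆ (Iio 0 ∪ Icc 0 T) ∪ Ioi T := fun u _ => by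
      rcases lt_or_ge u 0 with h | h
      · exact .inl (.inl h)
      · exact (le_or_gt u T).imp (fun h' => .inr ⟨h, h'⟩) id
    have hz : ∫⁻ u in Ioi T, ‖mvnSum a c u‖ₑ ^ 2 = 0 :=
      setLIntegral_eq_zero measurableSet_Ioi fun u hu => by
        rw [mvnSum_of_gt h0 hT c hu]; simp
    rw [← setLIntegral_univ]
    refine (lintegral_mono_set hsub).trans ((lintegral_union_le _ _ _).trans ?_)
    rw [hz, add_zero]
    exact lintegral_union_le _ _ _
  -- The first constant comes from discarding everything outside `[0, T]`; the second adds the Hardy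
  -- bound on the past to the exact contribution of `[0, T]`.
  refine ⟨mvnConst a / Real.Gamma (1 - a) ^ 2,
    (((Real.Gamma a)⁻¹ * S) ^ 2 + Real.Gamma (1 - a) ^ 2) / mvnConst a, by positivity,
    by positivity, fun f => ⟨?_, ?_⟩⟩
  · have h := (setLIntegral_le_lintegral (Icc 0 T) _).trans_eq (lintegral_mvnSum_sq h0 h1 hH f)
    rw [hmid, mul_comm, ← ENNReal.le_div_iff_mul_le (.inl (by simp [hG.ne']))
      (.inl ENNReal.ofReal_ne_top), ← ENNReal.ofReal_div_of_pos (by positivity)] at h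
    convert! h using 2
    ring
  · have h := hsplit (SimpleFn.coeff f)
    rw [lintegral_mvnSum_sq h0 h1 hH, hmid] at h
    have h2 := h.trans (add_le_add_left (hleft _) _)
    rw [← add_mul, ← ENNReal.ofReal_add (by positivity) (by positivity),
      ENNReal.ofReal_mul hc.le] at h2
    rw [ENNReal.ofReal_div_of_pos hc, ← ENNReal.mul_div_right_comm,
      ENNReal.le_div_iff_mul_le (.inl (by simpa using hc)) (.inl ENNReal.ofReal_ne_top), mul_comm]
    exact h2

end


/-! ### The fractional derivative as an operator into `L²`, and totality of its range -/

section

variable {T : ℝ} {X : Type*} [NormedAddCommGroup X] [InnerProductSpace ℝ X]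

/-- The fractional derivative is a linear map from step functions to `L²([0,T]; X)`, bounded above
and below for the norm of `𝓜`. -/
lemma exists_fracDeriv_clm [CompleteSpace X] {H : Ioo (0 : ℝ) 1} {a : ℝ} (h0 : 0 < a)
    (h1 : a < 1 / 2) (hH : 2 * (H : ℝ) = 1 - 2 * a) (hT : 0 ≤ T) :
    ∃ D : SimpleFn T X H →L[ℝ] L2Interval T X,
      (∀ f, (D f : ℝ → X) =ᵐ[volume.restrict (Icc 0 T)] fracDeriv a (SimpleFn.coeff f)) ∧
      ∃ B : ℝ, 0 < B ∧ ∀ f, ‖f‖ ≤ B * ‖D f‖ := by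
  obtain ⟨A, B, hA, hB, hAB⟩ := exists_norm_fracDeriv_equiv (X := X) h0 h1 hH hT
  have hLp : ∀ f : SimpleFn T X H,
      MemLp (fracDeriv a (SimpleFn.coeff f)) 2 (volume.restrict (Icc 0 T)) := fun f => by
    refine ⟨(stronglyMeasurable_fracDeriv _ _).aestronglyMeasurable, ?_⟩
    rw [← ENNReal.pow_lt_top_iff (n := 2) |>.trans (or_iff_left two_ne_zero)]
    have hsq := eLpNorm_nnreal_pow_eq_lintegral (μ := volume.restrict (Icc 0 T))
      (f := fracDeriv a (SimpleFn.coeff f)) (p := 2) two_ne_zero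
    simp only [NNReal.coe_ofNat, ENNReal.coe_ofNat, ENNReal.rpow_ofNat] at hsq
    rw [hsq]
    exact (hAB f).1.trans_lt ENNReal.ofReal_lt_top
  have hsq : ∀ f, ENNReal.ofReal (‖(hLp f).toLp‖ ^ 2) =
      ∫⁻ u in Icc 0 T, ‖fracDeriv a (SimpleFn.coeff f) u‖ₑ ^ 2 := fun f => by
    rw [ENNReal.ofReal_pow (norm_nonneg _), ofReal_norm, enorm_Lp_sq]
    refine lintegral_congr_ae ?_
    filter_upwards [(hLp f).coeFn_toLp] with u hu
    rw [hu]
  let L : SimpleFn T X H →ₗ[ℝ] L2Interval T X :=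
    { toFun := fun f => (hLp f).toLp
      map_add' := fun f g => by
        rw [← MemLp.toLp_add, MemLp.toLp_eq_toLp_iff, map_add, fracDeriv_add]
      map_smul' := fun r f => by
        rw [RingHom.id_apply, ← MemLp.toLp_const_smul, MemLp.toLp_eq_toLp_iff, map_smul,
          fracDeriv_smul] }
  refine ⟨L.mkContinuous (√A) fun f => ?_, fun f => (hLp f).coeFn_toLp, √B, Real.sqrt_pos.2 hB,
    fun f => ?_⟩
  · have h := (hAB f).1
    rw [← hsq, ENNReal.ofReal_le_ofReal_iff (by positivity)] at h
    rw [← Real.sqrt_sq (norm_nonneg f), ← Real.sqrt_mul hA.le]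
    exact Real.le_sqrt_of_sq_le h
  · have h := (hAB f).2
    rw [← hsq, ← ENNReal.ofReal_mul hB.le, ENNReal.ofReal_le_ofReal_iff (by positivity)] at h
    change ‖f‖ ≤ √B * ‖(hLp f).toLp‖
    rw [← Real.sqrt_sq (norm_nonneg (hLp f).toLp), ← Real.sqrt_mul hB.le]
    exact Real.le_sqrt_of_sq_le h

/-- The functions `(s - ·)₊ ^ (-a) x` are total in `L²([0,T]; X)`. -/
lemma eq_zero_of_forall_inner_fracDeriv [TopologicalSpace.SeparableSpace X] {a : ℝ} (h0 : 0 < a)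
    (h1 : a < 1) (h : L2Interval T X)
    (horth : ∀ c : Ioc (0 : ℝ) T →₀ X, ∫ u in Icc 0 T, inner ℝ (fracDeriv a c u) (h u) = 0) :
    h = 0 := by
  have : SecondCountableTopology X := UniformSpace.secondCountable_of_separable X
  have hG : (Real.Gamma (1 - a))⁻¹ ≠ 0 :=
    inv_ne_zero (Real.Gamma_pos_of_pos (sub_pos.2 h1)).ne'
  have hi : Integrable h (volume.restrict (Icc 0 T)) := (Lp.memLp h).integrable (by norm_num)
  refine (Lp.eq_zero_iff_ae_eq_zero).2 (ae_eq_zero_of_forall_inner (𝕜 := ℝ) fun x => ?_)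
  -- Orthogonality to the one-node family at `s` says that the left-sided fractional integral of
  -- order `1 - a` of `⟨x, h⟩` vanishes at `s`. The point `0`, which is not an admissible node, is
  -- null.
  refine ae_eq_zero_of_integral_posPow_left (β := 1 - a) (by linarith) (by linarith)
    (hi.const_inner x) ?_
  have hpos : ∀ᵐ s ∂(volume.restrict (Icc 0 T)), s ∈ Ioc 0 T := by
    rw [← Measure.restrict_congr_set Ioc_ae_eq_Icc]
    exact ae_restrict_mem measurableSet_Ioc
  filter_upwards [hpos] with s hs
  have hs' := horth (Finsupp.single ⟨s, hs⟩ x)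
  simp only [fracDeriv_single, real_inner_smul_left, mul_assoc, integral_const_mul] at hs'
  simpa only [sub_sub_cancel_left, smul_eq_mul] using (mul_eq_zero.1 hs').resolve_left hG

end

end

/-! ### The isomorphism of `𝓜` with `L²` and the conclusion -/

theorem proposition3p1 {X : Type*} [NormedAddCommGroup X] [InnerProductSpace ℝ X] [CompleteSpace X]
    [TopologicalSpace.SeparableSpace X] (T : ℝ) (hT : 0 < T)
    (H : Set.Ioo (0 : ℝ) 1) (hH : (H : ℝ) < 1 / 2) :
    ∃ J : FBmIntegrands T X H →L[ℝ] L2Interval T X,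
      (∀ f : SimpleFn T X H,
        (J (f : FBmIntegrands T X H) : ℝ → X)
          =ᵐ[(volume : Measure ℝ).restrict (Set.Icc 0 T)] f.toFun) ∧
      Function.Injective J ∧
      Set.range J = fracSobolevSpace X (1 / 2 - (H : ℝ)) T ∧
      ∃ c C : ℝ, 0 < c ∧ 0 < C ∧
        ∀ (m : FBmIntegrands T X H) (φ : L2Interval T X),
          IsFracIntegral (1 / 2 - (H : ℝ)) φ (J m) →
            c * ‖φ‖ ≤ ‖m‖ ∧ ‖m‖ ≤ C * ‖φ‖ := by
  have hH0 : 0 < (H : ℝ) := H.2.1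
  set a : ℝ := 1 / 2 - (H : ℝ) with ha
  have h0 : 0 < a := by linarith
  have h1 : a < 1 / 2 := by linarith
  have ha1 : a < 1 := by linarith
  obtain ⟨I, hI⟩ := exists_fracIntegral_clm (X := X) h0 ha1 T
  obtain ⟨D, hD, B, hB, hDB⟩ := exists_fracDeriv_clm (X := X) (H := H) h0 h1 (by linarith) hT.le
  let E : FBmIntegrands T X H →L[ℝ] L2Interval T X := D.extend UniformSpace.Completion.toComplL
  have hE : ∀ f : SimpleFn T X H, E f = D f := fun f =>
    D.extend_eq UniformSpace.Completion.denseRange_coe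
      (UniformSpace.Completion.isUniformInducing_coe _) f
  have hEB : ∀ m, ‖m‖ ≤ B * ‖E m‖ := fun m => by
    induction m using UniformSpace.Completion.induction_on with
    | hp => exact isClosed_le (by fun_prop) (by fun_prop)
    | ih f => rw [hE, UniformSpace.Completion.norm_coe]; exact hDB f
  have hEinj : Function.Injective E := by
    rw [injective_iff_map_eq_zero]
    intro m hm
    have := hEB m
    rw [hm, norm_zero, mul_zero] at this
    exact norm_le_zero_iff.1 this
  -- The lower bound makes `E` antilipschitz, and `𝓜` is complete.
  have hEclosed : IsClosed (LinearMap.range E.toLinearMap : Set (L2Interval T X)) := by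
    have := (E.antilipschitz_of_bound (K := B.toNNReal)
      (fun m => by rw [Real.coe_toNNReal _ hB.le]; exact hEB m)).isClosed_range E.uniformContinuous
    rwa [← ContinuousLinearMap.coe_coe, ← LinearMap.coe_range] at this
  have hEsurj : Function.Surjective E := by
    have htop : (LinearMap.range E.toLinearMap).topologicalClosure = ⊤ := by
      rw [Submodule.topologicalClosure_eq_top_iff, Submodule.eq_bot_iff]
      intro h hh
      refine eq_zero_of_forall_inner_fracDeriv h0 ha1 h fun c => ?_
      have := (Submodule.mem_orthogonal _ _).1 hh
        (E ((SimpleFn.coeff.symm c : SimpleFn T X H) : FBmIntegrands T X H)) ⟨_, rfl⟩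
      rw [hE, L2.inner_def] at this
      refine Eq.trans (integral_congr_ae ?_) this
      filter_upwards [hD (SimpleFn.coeff.symm c)] with u hu
      rw [hu, LinearEquiv.apply_symm_apply]
    rw [hEclosed.submodule_topologicalClosure_eq] at htop
    exact LinearMap.range_eq_top.1 htop
  -- Injectivity of the fractional integral identifies `φ` with `E m`, so both norm bounds reduce to
  -- those of `E`.
  have hIE : ∀ m φ, IsFracIntegral a φ ((I ∘L E) m) → φ = E m := fun m φ h =>
    h.unique h0 ha1 (hI (E m))
  -- The summand `1` keeps the constant positive even when `E = 0`, as happens for trivial `X`.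
  refine ⟨I ∘L E, fun f => ?_, ?_, ?_, (‖E‖ + 1)⁻¹, B, by positivity, hB, fun m φ h => ?_⟩
  · have h := hI (D f)
    rw [ContinuousLinearMap.comp_apply, hE]
    filter_upwards [h, ae_restrict_mem measurableSet_Icc] with t ht htT
    rw [ht, fracIntegral_eq ha1 htT.1, ← SimpleFn.stepMap_coeff,
      ← fracIntegral_fracDeriv h0 ha1 (SimpleFn.coeff f) htT.1, fracIntegral_eq ha1 htT.1]
    congr 1
    refine integral_congr_ae ?_
    filter_upwards [hD f] with s hs
    rw [hs]
  · intro m n hmn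
    have h := hI (E m)
    rw [show I (E m) = (I ∘L E) n from hmn] at h
    exact hEinj (hIE n _ h)
  · ext g
    constructor
    · rintro ⟨m, rfl⟩
      exact ⟨E m, hI (E m)⟩
    · rintro ⟨φ, hφ⟩
      obtain ⟨m, rfl⟩ := hEsurj φ
      refine ⟨m, Lp.ext ?_⟩
      exact (hI (E m)).trans hφ.symm
  · rw [hIE m φ h]
    refine ⟨?_, hEB m⟩
    rw [inv_mul_le_iff₀ (by positivity)]
    refine (E.le_opNorm m).trans ?_
    have := norm_nonneg m
    gcongr
    linarith
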